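/- Let $n\in\mathbb N$, $T>0$, and for $j=1,\dots,n$ let $\theta_j=\gamma_j/q_j$ with coprime integers $\gamma_j\ge 1$, $q_j\ge 2$. Let $q=\operatorname{lcm}(q_1,\dots,q_n)$ and let initial data $v_{j,0}^{(k)}\in\mathbb C$ ($0\le k<\lceil\theta_j\rceil$) be given; put $\psi_j(t)=\sum_{k=0}^{\lceil\theta_j\rceil-1}\frac{v_{j,0}^{(k)}}{k!}t^k$. Let $f_{j,r}$ ($1\le j\le n$, $1\le r\le n+1$) be complex-valued functions of $t\in\mathbb R$, let $\Omega\subset\mathbb R$ be a nonempty set of frequencies, and suppose that for every $\omega\in\Omega$ each function $p_{j,r}(t)=f_{j,r}(t)e^{i\omega t}$ is continuous on $[0,T]$ and satisfies $p_{j,r}(t)=\bar p_{j,r}(t^{1/q})$ for all sufficiently small $t\ge 0$, with some $\bar p_{j,r}$ analytic in a neighbourhood of the origin. Consider the system $$D_C^{\theta_j}v_j(t)=\sum_{r=1}^n p_{j,r}(t)v_r(t)+p_{j,n+1}(t),\qquad v_j^{(k)}(0)=v_{j,0}^{(k)},\quad 0\le k<\lceil\theta_j\rceil,\qquad t\in[0,T],\tag{1}$$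 where $D_C^{\theta}=I^{\lceil\theta\rceil-\theta}\partial_t^{\lceil\theta\rceil}$ is the Caputo derivative and $I^{\alpha}g(t)=\frac1{\Gamma(\alpha)}\int_0^t(t-s)^{\alpha-1}g(s)\,ds$. A solution of (1) is a tuple $(v_1,\dots,v_n)$ with $v_j\in C^{\lceil\theta_j\rceil-1}[0,T]$ and $v_j^{(\lceil\theta_j\rceil-1)}$ absolutely continuous, which satisfies the initial conditions, and the differential equations for almost every $t$. Then there are complex numbers $c_{j,r,i}$ ($i\ge 0$) and $a_{j,m,k}$ ($0\le k\le m$), not depending on $\omega\in\Omega$, such that, with the polynomials $$G_{j,m}(z)=\sum_{k=0}^{m}a_{j,m,k}\frac{z^k}{k!},$$ the following hold. 1. For some $\delta>0$, $f_{j,r}(t)=\sum_{i=0}^\infty c_{j,r,i}\,t^{i/q}$ for all $j,r$ and $0\le t\le\delta$. 2. The $G_{j,m}$ are determined recursively by the data and the earlier coefficients. For $z\in\mathbb C$ put $\bar v_{j,\mu}(z)=G_{j,\mu-\theta_jq}(z)$ if $\mu\ge\theta_jq$; for $\mu<\theta_jq$ put $\bar v_{j,\mu}(z)=v_{j,0}^{(\mu/q)}/(\mu/q)!$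 if $q\mid\mu$ and $\bar v_{j,\mu}(z)=0$ otherwise. Then for all $j$, $m\ge0$ and $z\in\mathbb C$ $$G_{j,m}(z)=\sum_{k=0}^{m}b_{j,m,k}(z)\frac{z^k}{k!},$$ where, with $\mu=m+\theta_jq$, $$b_{j,m,k}(z)=\frac{\Gamma(\frac{\mu}{q}-\theta_j+1)}{\Gamma(\frac{\mu}{q}+1)}\Bigl(\sum_{r=1}^n\sum_{\nu=0}^{m-qk}c_{j,r,m-qk-\nu}\,\bar v_{r,\nu}(z)+c_{j,n+1,m-qk}\Bigr)\quad\text{if }qk\le m,$$ and $b_{j,m,k}(z)=0$ if $qk>m$; only $\bar v_{r,\nu}$ with $\nu<\mu$ occur here. 3. For every $\omega\in\Omega$ there is $\delta\in(0,T]$ such that every solution $(v_1,\dots,v_n)$ of (1) satisfies $$v_j(t)=\psi_j(t)+\sum_{\mu=\theta_jq}^{\infty}G_{j,\mu-\theta_jq}(i\omega)\,t^{\mu/q},\qquad 0\le t\le\delta,\quad j=1,\dots,n,$$ the series being absolutely convergent. -/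

import Mathlib

open Filter Topology MeasureTheory

noncomputable section

namespace FracSystem

/-- The Riemann-Liouville fractional integral of order `α`, based at `0`:
`(I^α g)(t) = (1 / Γ(α)) ∫_0^t (t - s)^(α - 1) g(s) ds`. -/
def rlIntegral (α : ℝ) (g : ℝ → ℂ) (t : ℝ) : ℂ :=
  (((Real.Gamma α)⁻¹ : ℝ) : ℂ) * ∫ s in (0 : ℝ)..t, (((t - s) ^ (α - 1) : ℝ) : ℂ) * g s

/-- The Caputo derivative `D_C^θ v = I^(⌈θ⌉ - θ) (∂^⌈θ⌉ v)`, used for non-integer `θ > 0`. -/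
def caputoDeriv (θ : ℝ) (v : ℝ → ℂ) (t : ℝ) : ℂ :=
  rlIntegral ((⌈θ⌉₊ : ℝ) - θ) (iteratedDeriv ⌈θ⌉₊ v) t

/-- `v` solves, on `[0, T]`, the initial value problem
`D_C^(θ_j) v_j = ∑_{r=1}^n p_{j,r} v_r + p_{j,n+1}`, `v_j^(k)(0) = v0_{j,k}` for `k < ⌈θ_j⌉`
(the index `n+1` is `Fin.last n`).  Each `v_j` lies in the usual class on which the Caputo
derivative of order `θ_j` is defined: with `m = ⌈θ_j⌉`, `v_j` is `C^(m-1)` on `[0, T]` and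
`v_j^(m-1)` is absolutely continuous.  Then `∂^m v_j` exists almost everywhere and is integrable,
and the equation is required almost everywhere. -/
structure IsSolution {n : ℕ} (θ : Fin n → ℝ) (T : ℝ) (v0 : Fin n → ℕ → ℂ)
    (p : Fin n → Fin (n + 1) → ℝ → ℂ) (v : Fin n → ℝ → ℂ) : Prop where
  contDiffOn : ∀ j, ContDiffOn ℝ ((⌈θ j⌉₊ - 1 : ℕ) : ℕ∞) (v j) (Set.Icc 0 T)
  absCont : ∀ j,
    AbsolutelyContinuousOnInterval (iteratedDerivWithin (⌈θ j⌉₊ - 1) (v j) (Set.Icc 0 T)) 0 T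
  initial : ∀ j, ∀ k < ⌈θ j⌉₊, iteratedDerivWithin k (v j) (Set.Icc 0 T) 0 = v0 j k
  equation : ∀ j, ∀ᵐ t ∂(volume.restrict (Set.Icc 0 T)),
    caputoDeriv (θ j) (v j) t =
      (∑ r : Fin n, p j r.castSucc t * v r t) + p j (Fin.last n) t

/-- The Taylor polynomial `ψ(t) = ∑_{k < ⌈θ⌉} (v0_k / k!) t^k` of the initial data. -/
def psi (θ : ℝ) (v0 : ℕ → ℂ) (t : ℝ) : ℂ :=
  ∑ k ∈ Finset.range ⌈θ⌉₊, v0 k / (k.factorial : ℂ) * (t : ℂ) ^ k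

/-- The order `θ_j = γ_j / d_j` of the `j`-th equation. -/
def order {n : ℕ} (γ d : Fin n → ℕ) (j : Fin n) : ℝ := (γ j : ℝ) / (d j : ℝ)

/-- The least common multiple `q` of the denominators. -/
def lcmDen {n : ℕ} (d : Fin n → ℕ) : ℕ := Finset.univ.lcm d

/-- The natural number `θ_j q` (`d_j` divides `q`, so that the division is exact). -/
def startIndex {n : ℕ} (γ d : Fin n → ℕ) (j : Fin n) : ℕ := γ j * (lcmDen d / d j)

/-- The coefficient functions `p_{j,r}(t) = f_{j,r}(t) e^(iωt)`. -/
def oscCoeff {n : ℕ} (f : Fin n → Fin (n + 1) → ℝ → ℂ) (ω : ℝ) (j : Fin n) (r : Fin (n + 1))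
    (t : ℝ) : ℂ :=
  f j r t * Complex.exp (Complex.I * ω * t)

/-- Near the origin (on the side `t ≥ 0`) `p(t) = p̄(t^(1/q))` with `p̄` analytic at `0`. -/
def IsAnalyticInRoot (q : ℕ) (p : ℝ → ℂ) : Prop :=
  ∃ pbar : ℝ → ℂ, AnalyticAt ℝ pbar 0 ∧
    ∀ᶠ t in 𝓝[≥] (0 : ℝ), p t = pbar (t ^ (1 / (q : ℝ)))

/-- The function `G_{j,m}(z) = ∑_{k=0}^m a_{j,m,k} z^k / k!`, a polynomial in `z`. -/
def G {n : ℕ} (a : Fin n → ℕ → ℕ → ℂ) (j : Fin n) (m : ℕ) (z : ℂ) : ℂ :=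
  ∑ k ∈ Finset.range (m + 1), a j m k * z ^ k / (k.factorial : ℂ)

/-- The full coefficient sequence `v̄_{j,μ}` of `v_j = ∑ v̄_{j,μ} t^(μ/q)`: the coefficients of
`ψ_j` for `μ < θ_j q`, and `G_{j,μ-θ_j q}(z)` for `μ ≥ θ_j q`. -/
def vbar {n : ℕ} (γ d : Fin n → ℕ) (v0 : Fin n → ℕ → ℂ) (a : Fin n → ℕ → ℕ → ℂ) (z : ℂ)
    (j : Fin n) (μ : ℕ) : ℂ :=
  if μ < startIndex γ d j then
    (if lcmDen d ∣ μ then v0 j (μ / lcmDen d) / ((μ / lcmDen d).factorial : ℂ) else 0)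
  else G a j (μ - startIndex γ d j) z

/-- The factor `ξ̄ = Γ(μ/q - θ_j + 1) / Γ(μ/q + 1)`. -/
def xi {n : ℕ} (γ d : Fin n → ℕ) (j : Fin n) (μ : ℕ) : ℝ :=
  Real.Gamma ((μ : ℝ) / (lcmDen d : ℝ) - order γ d j + 1) /
    Real.Gamma ((μ : ℝ) / (lcmDen d : ℝ) + 1)

/-- The coefficient of `z^k / k!` in `v̄_{j,μ}`, `μ = m + θ_j q`, written through the expansion
coefficients `c_{j,r,i}` of `f_{j,r}(t) = ∑ c_{j,r,i} t^(i/q)`, the factor `ξ̄`, and coefficients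
`w_{r,ν}` with `ν ≤ m < μ` only.  The `k`-th term of `e^(zt)` has `t`-exponent `k = q k / q`. -/
def recCoeff {n : ℕ} (γ d : Fin n → ℕ) (c : Fin n → Fin (n + 1) → ℕ → ℂ) (w : Fin n → ℕ → ℂ)
    (j : Fin n) (m k : ℕ) : ℂ :=
  if lcmDen d * k ≤ m then
    (xi γ d j (m + startIndex γ d j) : ℂ) *
      ((∑ r : Fin n, ∑ ν ∈ Finset.range (m - lcmDen d * k + 1),
          c j r.castSucc (m - lcmDen d * k - ν) * w r ν)
        + c j (Fin.last n) (m - lcmDen d * k))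
  else 0

end FracSystem

end

open Filter Topology MeasureTheory

noncomputable section

namespace FracSystem

/-! The initial value problem is turned into a Volterra equation, which is solved by a power series
in `s = t^(1/q)` and has only one continuous solution near `0`.

Applying `I^θ` to the equation and using `I^a I^b = I^(a+b)` (`rlIntegral_rlIntegral`) together with
Taylor's formula with integral remainder shows that every solution satisfies `v_j = ψ_j + I^(θ_j)(∑
p_{j,r} v_r + p_{j,n+1})` (`IsSolution.eq_psi_add_rlIntegral`).

In the variable `s` the data `f` and `e^(zt) = e^(z s^q)` are convergent power series, and `I^θ`
sends `t^ρ` to `Γ(ρ+1)/Γ(ρ+θ+1) t^(ρ+θ)`. Comparing coefficients gives exactly the recursion for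
`G`. Since `θ_j q ≥ 1`, each coefficient depends only on earlier ones, and the Gamma quotients are
bounded, so the coefficients grow at most geometrically (`exists_geometric_bound`). The series
therefore converges near `0` and may be integrated term by term, so its sum solves the Volterra
equation (`exists_series_solution`).

On a short interval the linear part of the Volterra operator has norm at most `1/2`, so the solution
and the series agree (`eqOn_of_volterra`). The frequency enters only through `z = iω`. The expansion
of `f`, hence `c` and `a`, is the same for all `ω`. -/

/-! ### Beta integrals and the Riemann-Liouville integral. -/

theorem integral_rpow_mul_sub_rpow {u v a : ℝ} (hu : 0 < u) (hv : 0 < v) (ha : 0 < a) :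
    ∫ s in (0 : ℝ)..a, s ^ (u - 1) * (a - s) ^ (v - 1) =
      a ^ (u + v - 1) * (Real.Gamma u * Real.Gamma v / Real.Gamma (u + v)) := by
  have h := Complex.betaIntegral_scaled (u : ℂ) (v : ℂ) ha
  have hB := Complex.Gamma_mul_Gamma_eq_betaIntegral (s := (u : ℂ)) (t := (v : ℂ))
    (by simpa using hu) (by simpa using hv)
  have hG : Real.Gamma (u + v) ≠ 0 := (Real.Gamma_pos_of_pos (by positivity)).ne'
  rw [← Complex.ofReal_add, Complex.Gamma_ofReal, Complex.Gamma_ofReal, Complex.Gamma_ofReal] at hB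
  have hB' : Complex.betaIntegral u v =
      ((Real.Gamma u * Real.Gamma v / Real.Gamma (u + v) : ℝ) : ℂ) := by
    push_cast
    rw [eq_div_iff (by exact_mod_cast hG), hB, mul_comm]
  have hI : ∫ x in (0 : ℝ)..a, (x : ℂ) ^ ((u : ℂ) - 1) * ((a : ℂ) - x) ^ ((v : ℂ) - 1) =
      ∫ x in (0 : ℝ)..a, ((x ^ (u - 1) * (a - x) ^ (v - 1) : ℝ) : ℂ) := by
    refine intervalIntegral.integral_congr fun x hx => ?_
    rw [Set.uIcc_of_le ha.le] at hx
    rw [Complex.ofReal_mul, Complex.ofReal_cpow hx.1, Complex.ofReal_cpow (sub_nonneg.2 hx.2)]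
    push_cast
    rfl
  rw [hI, intervalIntegral.integral_ofReal, hB'] at h
  have e : (a : ℂ) ^ ((u : ℂ) + v - 1) = ((a ^ (u + v - 1) : ℝ) : ℂ) := by
    rw [Complex.ofReal_cpow ha.le]
    push_cast
    rfl
  rw [e] at h
  exact_mod_cast h

theorem integral_sub_rpow_mul_sub_rpow {a b x y : ℝ} (ha : 0 < a) (hb : 0 < b) (hxy : x < y) :
    ∫ s in x..y, (y - s) ^ (a - 1) * (s - x) ^ (b - 1) =
      (y - x) ^ (a + b - 1) * (Real.Gamma a * Real.Gamma b / Real.Gamma (a + b)) := by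
  have h := intervalIntegral.integral_comp_sub_right (a := x) (b := y)
    (fun s => s ^ (b - 1) * ((y - x) - s) ^ (a - 1)) x
  rw [sub_self, integral_rpow_mul_sub_rpow hb ha (sub_pos.2 hxy)] at h
  rw [add_comm a b, mul_comm (Real.Gamma a), ← h]
  refine intervalIntegral.integral_congr fun s _ => ?_
  rw [mul_comm, sub_sub_sub_cancel_right]

/-- A non-integrable function has integral `0` by convention, whereas the Beta integral is positive.
-/
theorem intervalIntegrable_sub_rpow_mul_sub_rpow {a b x y : ℝ} (ha : 0 < a) (hb : 0 < b)
    (hxy : x < y) :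
    IntervalIntegrable (fun s => (y - s) ^ (a - 1) * (s - x) ^ (b - 1)) volume x y := by
  refine intervalIntegral.intervalIntegrable_of_integral_ne_zero ?_
  rw [integral_sub_rpow_mul_sub_rpow ha hb hxy]
  have := Real.rpow_pos_of_pos (sub_pos.2 hxy) (a + b - 1)
  have := Real.Gamma_pos_of_pos ha
  have := Real.Gamma_pos_of_pos hb
  have := Real.Gamma_pos_of_pos (add_pos ha hb)
  positivity

theorem intervalIntegrable_kernel {α t : ℝ} (hα : 0 < α) (ht : 0 ≤ t) :
    IntervalIntegrable (fun s => (t - s) ^ (α - 1)) volume 0 t := by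
  rcases ht.eq_or_lt with rfl | ht
  · simp
  · simpa using intervalIntegrable_sub_rpow_mul_sub_rpow hα one_pos ht

theorem integral_kernel {α t : ℝ} (hα : 0 < α) (ht : 0 ≤ t) :
    ∫ s in (0 : ℝ)..t, (t - s) ^ (α - 1) = t ^ α * (Real.Gamma α / Real.Gamma (α + 1)) := by
  rcases ht.eq_or_lt with rfl | ht
  · simp [Real.zero_rpow hα.ne']
  · simpa using integral_sub_rpow_mul_sub_rpow hα one_pos ht

theorem intervalIntegrable_kernel_mul {α t : ℝ} (hα : 0 < α) (ht : 0 ≤ t) {g : ℝ → ℂ}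
    (hg : ContinuousOn g (Set.Icc 0 t)) :
    IntervalIntegrable (fun s => (((t - s) ^ (α - 1) : ℝ) : ℂ) * g s) volume 0 t := by
  refine IntervalIntegrable.mul_continuousOn ?_ (by rwa [Set.uIcc_of_le ht])
  exact ⟨(intervalIntegrable_kernel hα ht).1.ofReal, (intervalIntegrable_kernel hα ht).2.ofReal⟩

theorem rlIntegral_congr_ae {α t : ℝ} (ht : 0 ≤ t) {g h : ℝ → ℂ}
    (hgh : ∀ᵐ s ∂(volume.restrict (Set.Icc 0 t)), g s = h s) :
    rlIntegral α g t = rlIntegral α h t := by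
  unfold rlIntegral
  congr 1
  refine intervalIntegral.integral_congr_ae ?_
  rw [ae_restrict_iff' measurableSet_Icc] at hgh
  filter_upwards [hgh] with s hs hs'
  rw [Set.uIoc_of_le ht] at hs'
  rw [hs (Set.Ioc_subset_Icc_self hs')]

theorem rlIntegral_congr {α t : ℝ} (ht : 0 ≤ t) {g h : ℝ → ℂ}
    (hgh : ∀ s ∈ Set.Icc 0 t, g s = h s) : rlIntegral α g t = rlIntegral α h t :=
  rlIntegral_congr_ae ht ((ae_restrict_iff' measurableSet_Icc).2 (ae_of_all _ hgh))

theorem rlIntegral_sub {α t : ℝ} (hα : 0 < α) (ht : 0 ≤ t) {g h : ℝ → ℂ}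
    (hg : ContinuousOn g (Set.Icc 0 t)) (hh : ContinuousOn h (Set.Icc 0 t)) :
    rlIntegral α (fun s => g s - h s) t = rlIntegral α g t - rlIntegral α h t := by
  unfold rlIntegral
  rw [← mul_sub, ← intervalIntegral.integral_sub (intervalIntegrable_kernel_mul hα ht hg)
    (intervalIntegrable_kernel_mul hα ht hh)]
  simp only [mul_sub]

theorem norm_rlIntegral_le {α t B : ℝ} (hα : 0 < α) (ht : 0 ≤ t) {g : ℝ → ℂ}
    (hg : ∀ s ∈ Set.Icc 0 t, ‖g s‖ ≤ B) :
    ‖rlIntegral α g t‖ ≤ B * (t ^ α / Real.Gamma (α + 1)) := by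
  have hG := Real.Gamma_pos_of_pos hα
  have h1 : ‖∫ s in (0 : ℝ)..t, (((t - s) ^ (α - 1) : ℝ) : ℂ) * g s‖ ≤
      ∫ s in (0 : ℝ)..t, (t - s) ^ (α - 1) * B := by
    refine intervalIntegral.norm_integral_le_of_norm_le ht (ae_of_all _ fun s hs => ?_)
      ((intervalIntegrable_kernel hα ht).mul_const B)
    rw [norm_mul, Complex.norm_real,
      Real.norm_of_nonneg (Real.rpow_nonneg (sub_nonneg.2 hs.2) _)]
    exact mul_le_mul_of_nonneg_left (hg s (Set.Ioc_subset_Icc_self hs))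
      (Real.rpow_nonneg (sub_nonneg.2 hs.2) _)
  rw [intervalIntegral.integral_mul_const, integral_kernel hα ht] at h1
  unfold rlIntegral
  rw [norm_mul, Complex.norm_real, Real.norm_of_nonneg (inv_nonneg.2 hG.le)]
  refine (mul_le_mul_of_nonneg_left h1 (inv_nonneg.2 hG.le)).trans (le_of_eq ?_)
  field_simp

/-- The Beta integral again; this quotient of Gamma values is the source of the factor `xi`. -/
theorem rlIntegral_rpow {α ρ t : ℝ} (hα : 0 < α) (hρ : 0 ≤ ρ) (ht : 0 ≤ t) :
    rlIntegral α (fun s => ((s ^ ρ : ℝ) : ℂ)) t =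
      ((Real.Gamma (ρ + 1) / Real.Gamma (ρ + α + 1) * t ^ (ρ + α) : ℝ) : ℂ) := by
  rcases ht.eq_or_lt with rfl | ht
  · simp [rlIntegral, Real.zero_rpow (by positivity : ρ + α ≠ 0)]
  have h := integral_sub_rpow_mul_sub_rpow hα (by positivity : 0 < ρ + 1) ht
  simp only [sub_zero, add_sub_cancel_right] at h
  unfold rlIntegral
  simp_rw [← Complex.ofReal_mul]
  rw [intervalIntegral.integral_ofReal, h, ← Complex.ofReal_mul]
  have hG := (Real.Gamma_pos_of_pos hα).ne'
  rw [show α + (ρ + 1) - 1 = ρ + α by ring, show α + (ρ + 1) = ρ + α + 1 by ring]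
  congr 1
  field_simp

/-- Compare `I^α` of `s^ρ ≤ 1` with `I^α` of `1` at `t = 1`. The bound is uniform in `ρ`, which is
what makes the recursion factors bounded. -/
theorem Gamma_div_Gamma_le {α ρ : ℝ} (hα : 0 < α) (hρ : 0 ≤ ρ) :
    Real.Gamma (ρ + 1) / Real.Gamma (ρ + α + 1) ≤ 1 / Real.Gamma (α + 1) := by
  have h := norm_rlIntegral_le (B := 1) (g := fun s => ((s ^ ρ : ℝ) : ℂ)) hα zero_le_one
    (fun s hs => by
      rw [Complex.norm_real, Real.norm_of_nonneg (Real.rpow_nonneg hs.1 _)]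
      exact Real.rpow_le_one hs.1 hs.2 hρ)
  rw [rlIntegral_rpow hα hρ zero_le_one, Complex.norm_real] at h
  simpa using (le_abs_self _).trans h

theorem hasSum_rlIntegral {α t : ℝ} (hα : 0 < α) (ht : 0 ≤ t) {F : ℕ → ℝ → ℂ} {g : ℝ → ℂ}
    {B : ℕ → ℝ} (hB : Summable B) (hF : ∀ m, ContinuousOn (F m) (Set.Icc 0 t))
    (hFB : ∀ m, ∀ s ∈ Set.Icc 0 t, ‖F m s‖ ≤ B m)
    (hg : ∀ s ∈ Set.Icc 0 t, HasSum (fun m => F m s) (g s)) :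
    HasSum (fun m => rlIntegral α (F m) t) (rlIntegral α g t) := by
  unfold rlIntegral
  refine HasSum.mul_left _ ?_
  refine intervalIntegral.hasSum_integral_of_dominated_convergence
    (fun m s => |(t - s) ^ (α - 1)| * B m) (fun m => ?_) (fun m => ?_) ?_ ?_ ?_
  · exact (intervalIntegrable_kernel_mul hα ht (hF m)).aestronglyMeasurable_restrict_uIoc
  · refine ae_of_all _ fun s hs => ?_
    rw [Set.uIoc_of_le ht] at hs
    rw [norm_mul, Complex.norm_real, Real.norm_eq_abs]
    exact mul_le_mul_of_nonneg_left (hFB m s (Set.Ioc_subset_Icc_self hs)) (abs_nonneg _)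
  · exact ae_of_all _ fun s _ => hB.mul_left _
  · simp_rw [tsum_mul_left]
    exact (intervalIntegrable_kernel hα ht).abs.mul_const _
  · refine ae_of_all _ fun s hs => ?_
    rw [Set.uIoc_of_le ht] at hs
    exact (hg s (Set.Ioc_subset_Icc_self hs)).mul_left _

/-- Fubini on the triangle `r < s`, the inner integral over `s` being a Beta integral. The condition
`1 ≤ a + b` makes `(t - r)^(a+b-1)` continuous up to `r = t`, so its product with an integrable `g`
is integrable, and the identity holds at every `t > 0` rather than almost everywhere. -/
theorem rlIntegral_rlIntegral {a b t : ℝ} (ha : 0 < a) (hb : 0 < b) (hab : 1 ≤ a + b)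
    (ht : 0 < t) {g : ℝ → ℂ} (hg : IntegrableOn g (Set.Ioc 0 t)) :
    rlIntegral a (rlIntegral b g) t = rlIntegral (a + b) g t := by
  set μ : Measure ℝ := volume.restrict (Set.Ioc 0 t) with hμ
  set k : ℝ → ℝ → ℝ := fun s r => (t - s) ^ (a - 1) * (s - r) ^ (b - 1) with hk
  set F : ℝ → ℝ → ℂ := fun s r => (Set.Iio s).indicator (fun r => (k s r : ℂ) * g r) r with hF
  set C : ℝ := Real.Gamma a * Real.Gamma b / Real.Gamma (a + b) with hC
  have hGa := Real.Gamma_pos_of_pos ha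
  have hGb := Real.Gamma_pos_of_pos hb
  have hGab := Real.Gamma_pos_of_pos (add_pos ha hb)
  have hFr : ∀ r, (fun s => F s r) = (Set.Ioi r).indicator (fun s => (k s r : ℂ) * g r) := by
    intro r
    ext s
    simp only [hF, Set.indicator_apply, Set.mem_Iio, Set.mem_Ioi]
  have hmeas : AEStronglyMeasurable (Function.uncurry F) (μ.prod μ) := by
    have h1 : Function.uncurry F = {p : ℝ × ℝ | p.2 < p.1}.indicator
        (fun p => (k p.1 p.2 : ℂ) * g p.2) := by
      ext ⟨s, r⟩
      simp only [Function.uncurry, hF, Set.indicator_apply, Set.mem_Iio, Set.mem_ofPred_eq]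
    rw [h1]
    refine AEStronglyMeasurable.indicator ?_ (measurableSet_lt measurable_snd measurable_fst)
    refine AEStronglyMeasurable.mul ?_ hg.aestronglyMeasurable.comp_snd
    refine Measurable.aestronglyMeasurable ?_
    simp only [hk]
    fun_prop
  -- The point `r = t` is discarded because the Beta integral over `(r, t]` needs `r < t`.
  have hae : ∀ᵐ r ∂μ, 0 < r ∧ r < t := by
    have h2 : ∀ᵐ r ∂(volume : Measure ℝ), r ≠ t := by simp [ae_iff]
    rw [hμ, ae_restrict_iff' measurableSet_Ioc]
    filter_upwards [h2] with r hr hr'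
    exact ⟨hr'.1, lt_of_le_of_ne hr'.2 hr⟩
  have hinter : ∀ r, 0 < r → Set.Ioc 0 t ∩ Set.Ioi r = Set.Ioc r t := by
    intro r hr
    ext s
    simp only [Set.mem_inter_iff, Set.mem_Ioc, Set.mem_Ioi]
    exact ⟨fun h => ⟨h.2, h.1.2⟩, fun h => ⟨⟨hr.trans h.1, h.2⟩, h.1⟩⟩
  have hkint : ∀ r, r < t → IntegrableOn (fun s => k s r) (Set.Ioc r t) := fun r hr =>
    (intervalIntegrable_sub_rpow_mul_sub_rpow ha hb hr).1
  have hkval : ∀ r, r < t → ∫ s in Set.Ioc r t, k s r = (t - r) ^ (a + b - 1) * C := by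
    intro r hr
    rw [← intervalIntegral.integral_of_le hr.le]
    exact integral_sub_rpow_mul_sub_rpow ha hb hr
  have hcont : ContinuousOn (fun r : ℝ => ((t - r) ^ (a + b - 1) * C)) (Set.Icc 0 t) := by
    refine ContinuousOn.mul ?_ continuousOn_const
    exact (continuousOn_const.sub continuousOn_id).rpow_const fun r _ => Or.inr (by linarith)
  have hint : Integrable (Function.uncurry F) (μ.prod μ) := by
    rw [integrable_prod_iff' hmeas]
    constructor
    · filter_upwards [hae] with r hr
      change Integrable (fun s => F s r) μ
      rw [hFr, integrable_indicator_iff measurableSet_Ioi, IntegrableOn, hμ,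
        Measure.restrict_restrict measurableSet_Ioi, Set.inter_comm, hinter r hr.1]
      exact (hkint r hr.2).ofReal.mul_const _
    · have h3 : Integrable (fun r => ((t - r) ^ (a + b - 1) * C) * ‖g r‖) μ := by
        refine IntegrableOn.continuousOn_mul_of_subset hcont hg.norm isCompact_Icc
          measurableSet_Ioc Set.Ioc_subset_Icc_self
      refine h3.congr ?_
      filter_upwards [hae] with r hr
      change _ = ∫ s, ‖F s r‖ ∂μ
      have h4 : (fun s => ‖F s r‖) = (Set.Ioi r).indicator (fun s => |k s r| * ‖g r‖) := by
        ext s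
        rw [congrFun (hFr r) s, norm_indicator_eq_indicator_norm]
        simp only [norm_mul, Complex.norm_real, Real.norm_eq_abs]
      rw [h4, hμ, setIntegral_indicator measurableSet_Ioi, hinter r hr.1, integral_mul_const,
        ← hkval r hr.2]
      congr 1
      refine setIntegral_congr_fun measurableSet_Ioc fun s hs => ?_
      exact (abs_of_nonneg (mul_nonneg (Real.rpow_nonneg (sub_nonneg.2 hs.2) _)
        (Real.rpow_nonneg (sub_nonneg.2 hs.1.le) _))).symm
  have hswap := integral_integral_swap hint
  have hL : ∫ s, ∫ r, F s r ∂μ ∂μ = ∫ s in (0 : ℝ)..t, (((t - s) ^ (a - 1) : ℝ) : ℂ) *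
      ∫ r in (0 : ℝ)..s, (((s - r) ^ (b - 1) : ℝ) : ℂ) * g r := by
    rw [intervalIntegral.integral_of_le ht.le]
    refine setIntegral_congr_fun measurableSet_Ioc fun s hs => ?_
    have h5 : Set.Ioc 0 t ∩ Set.Iio s = Set.Ioo 0 s := by
      ext r
      simp only [Set.mem_inter_iff, Set.mem_Ioc, Set.mem_Iio, Set.mem_Ioo]
      exact ⟨fun h => ⟨h.1.1, h.2⟩, fun h => ⟨⟨h.1, h.2.le.trans hs.2⟩, h.2⟩⟩
    simp only [hF, hμ]
    rw [setIntegral_indicator measurableSet_Iio, h5, intervalIntegral.integral_of_le hs.1.le,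
      integral_Ioc_eq_integral_Ioo, ← integral_const_mul]
    simp only [hk, Complex.ofReal_mul, mul_assoc]
  have hR : ∫ r, ∫ s, F s r ∂μ ∂μ = (C : ℂ) * ∫ r in (0 : ℝ)..t,
      (((t - r) ^ (a + b - 1) : ℝ) : ℂ) * g r := by
    rw [intervalIntegral.integral_of_le ht.le, ← integral_const_mul]
    refine integral_congr_ae ?_
    filter_upwards [hae] with r hr
    rw [hFr, hμ, setIntegral_indicator measurableSet_Ioi, hinter r hr.1, integral_mul_const,
      integral_complex_ofReal, hkval r hr.2]
    push_cast
    ring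
  rw [hL, hR] at hswap
  have hU : rlIntegral a (rlIntegral b g) t = (((Real.Gamma a)⁻¹ : ℝ) : ℂ) *
      ((((Real.Gamma b)⁻¹ : ℝ) : ℂ) * ∫ s in (0 : ℝ)..t, (((t - s) ^ (a - 1) : ℝ) : ℂ) *
        ∫ r in (0 : ℝ)..s, (((s - r) ^ (b - 1) : ℝ) : ℂ) * g r) := by
    unfold rlIntegral
    congr 1
    rw [← intervalIntegral.integral_const_mul]
    refine intervalIntegral.integral_congr fun s _ => ?_
    ring
  rw [hU, hswap, rlIntegral, ← mul_assoc, ← mul_assoc, ← Complex.ofReal_mul, ← Complex.ofReal_mul]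
  congr 2
  rw [hC]
  field_simp

/-! ### Absolutely continuous complex-valued functions, through real and imaginary parts. -/

theorem absolutelyContinuousOnInterval_of_dist_le {X Y : Type*} [PseudoMetricSpace X]
    [PseudoMetricSpace Y] {f : ℝ → X} {g : ℝ → Y} {a b : ℝ}
    (hf : AbsolutelyContinuousOnInterval f a b)
    (hfg : ∀ x ∈ Set.uIcc a b, ∀ y ∈ Set.uIcc a b, dist (g x) (g y) ≤ dist (f x) (f y)) :
    AbsolutelyContinuousOnInterval g a b := by
  rw [absolutelyContinuousOnInterval_iff] at hf ⊢
  intro ε hε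
  obtain ⟨δ, hδ, h⟩ := hf ε hε
  refine ⟨δ, hδ, fun E hE hEδ => lt_of_le_of_lt ?_ (h E hE hEδ)⟩
  exact Finset.sum_le_sum fun i hi => hfg _ (hE.1 i hi).1 _ (hE.1 i hi).2

theorem absolutelyContinuousOnInterval_re {v : ℝ → ℂ} {a b : ℝ}
    (hv : AbsolutelyContinuousOnInterval v a b) :
    AbsolutelyContinuousOnInterval (fun x => (v x).re) a b := by
  refine absolutelyContinuousOnInterval_of_dist_le hv fun x _ y _ => ?_
  rw [Real.dist_eq, Complex.dist_eq, ← Complex.sub_re]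
  exact Complex.abs_re_le_norm _

theorem absolutelyContinuousOnInterval_im {v : ℝ → ℂ} {a b : ℝ}
    (hv : AbsolutelyContinuousOnInterval v a b) :
    AbsolutelyContinuousOnInterval (fun x => (v x).im) a b := by
  refine absolutelyContinuousOnInterval_of_dist_le hv fun x _ y _ => ?_
  rw [Real.dist_eq, Complex.dist_eq, ← Complex.sub_im]
  exact Complex.abs_im_le_norm _

theorem ae_deriv_eq_re_add_im {v : ℝ → ℂ} {a b : ℝ} (hv : AbsolutelyContinuousOnInterval v a b) :
    ∀ᵐ x, x ∈ Set.uIcc a b → deriv v x =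
      ((deriv (fun x => (v x).re) x : ℝ) : ℂ) + ((deriv (fun x => (v x).im) x : ℝ) : ℂ) * Complex.I := by
  filter_upwards [(absolutelyContinuousOnInterval_re hv).ae_differentiableAt,
    (absolutelyContinuousOnInterval_im hv).ae_differentiableAt] with x h1 h2 hx
  have h := (h1 hx).hasDerivAt.ofReal_comp.add
    ((h2 hx).hasDerivAt.ofReal_comp.mul_const Complex.I)
  rw [← h.deriv]
  congr 1
  ext y
  simp

theorem intervalIntegrable_deriv {v : ℝ → ℂ} {a b : ℝ}
    (hv : AbsolutelyContinuousOnInterval v a b) : IntervalIntegrable (deriv v) volume a b := by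
  have h1 := (absolutelyContinuousOnInterval_re hv).intervalIntegrable_deriv
  have h2 := (absolutelyContinuousOnInterval_im hv).intervalIntegrable_deriv
  have h3 : IntervalIntegrable (fun x => ((deriv (fun x => (v x).re) x : ℝ) : ℂ) +
      ((deriv (fun x => (v x).im) x : ℝ) : ℂ) * Complex.I) volume a b :=
    IntervalIntegrable.add ⟨h1.1.ofReal, h1.2.ofReal⟩
      (IntervalIntegrable.mul_const ⟨h2.1.ofReal, h2.2.ofReal⟩ _)
  refine h3.congr_ae ?_
  rw [Filter.EventuallyEq, ae_restrict_iff' measurableSet_uIoc]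
  filter_upwards [ae_deriv_eq_re_add_im hv] with x hx hx'
  exact (hx (Set.uIoc_subset_uIcc hx')).symm

theorem integral_smul_deriv_eq_deriv_smul {u : ℝ → ℝ} {v : ℝ → ℂ} {a b : ℝ}
    (hu : AbsolutelyContinuousOnInterval u a b) (hv : AbsolutelyContinuousOnInterval v a b) :
    ∫ x in a..b, u x • deriv v x = u b • v b - u a • v a - ∫ x in a..b, deriv u x • v x := by
  have hre := absolutelyContinuousOnInterval_re hv
  have him := absolutelyContinuousOnInterval_im hv
  have split : ∀ f g h : ℝ → ℝ, IntervalIntegrable (fun x => f x * g x) volume a b →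
      IntervalIntegrable (fun x => f x * h x) volume a b →
      ∫ x in a..b, f x • ((g x : ℂ) + (h x : ℂ) * Complex.I) =
        ((∫ x in a..b, f x * g x : ℝ) : ℂ) + ((∫ x in a..b, f x * h x : ℝ) : ℂ) * Complex.I := by
    intro f g h h1 h2
    rw [← intervalIntegral.integral_ofReal, ← intervalIntegral.integral_ofReal,
      ← intervalIntegral.integral_mul_const, ← intervalIntegral.integral_add]
    · refine intervalIntegral.integral_congr fun x _ => ?_
      simp only [Complex.real_smul]
      push_cast
      ring
    · exact ⟨h1.1.ofReal, h1.2.ofReal⟩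
    · exact IntervalIntegrable.mul_const ⟨h2.1.ofReal, h2.2.ofReal⟩ _
  have e1 : ∫ x in a..b, u x • deriv v x = ∫ x in a..b, u x •
      (((deriv (fun x => (v x).re) x : ℝ) : ℂ) + ((deriv (fun x => (v x).im) x : ℝ) : ℂ) * Complex.I) := by
    refine intervalIntegral.integral_congr_ae ?_
    filter_upwards [ae_deriv_eq_re_add_im hv] with x hx hx'
    rw [hx (Set.uIoc_subset_uIcc hx')]
  have e2 : ∫ x in a..b, deriv u x • v x =
      ∫ x in a..b, deriv u x • (((v x).re : ℂ) + ((v x).im : ℂ) * Complex.I) := by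
    simp only [Complex.re_add_im]
  rw [e1, e2, split, split, hu.integral_mul_deriv_eq_deriv_mul hre,
    hu.integral_mul_deriv_eq_deriv_mul him]
  · conv_rhs => rw [← Complex.re_add_im (v a), ← Complex.re_add_im (v b)]
    simp only [Complex.real_smul]
    push_cast
    ring
  · exact hu.intervalIntegrable_deriv.mul_continuousOn hre.continuousOn
  · exact hu.intervalIntegrable_deriv.mul_continuousOn him.continuousOn
  · exact hre.intervalIntegrable_deriv.continuousOn_mul hu.continuousOn
  · exact him.intervalIntegrable_deriv.continuousOn_mul hu.continuousOn

/-! ### Taylor's formula and the Volterra form of the problem. -/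

theorem iteratedDerivWithin_Icc_eq {v : ℝ → ℂ} {T t : ℝ} {n k : ℕ} (ht : 0 < t) (htT : t ≤ T)
    (hv : ContDiffOn ℝ n v (Set.Icc 0 T)) (hk : k ≤ n) {x : ℝ} (hx : x ∈ Set.Icc 0 t) :
    iteratedDerivWithin k v (Set.Icc 0 t) x = iteratedDerivWithin k v (Set.Icc 0 T) x := by
  simp only [iteratedDerivWithin]
  rw [iteratedFDerivWithin_subset (Set.Icc_subset_Icc_right htT) (uniqueDiffOn_Icc ht)
    (uniqueDiffOn_Icc (ht.trans_le htT)) (hv.of_le (by exact_mod_cast hk)) hx]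

theorem iteratedDerivWithin_Icc_eq_iteratedDeriv {v : ℝ → ℂ} {t x : ℝ} (k : ℕ)
    (hx : x ∈ Set.Ioo 0 t) : iteratedDerivWithin k v (Set.Icc 0 t) x = iteratedDeriv k v x := by
  have h : (Set.Icc 0 t : Set ℝ) =ᶠ[𝓝 x] Set.univ := by
    rw [eventuallyEq_univ]
    exact Icc_mem_nhds hx.1 hx.2
  rw [iteratedDerivWithin, iteratedFDerivWithin_congr_set h, ← iteratedDerivWithin_univ,
    iteratedDerivWithin]

theorem iteratedDeriv_succ_eq_deriv {v : ℝ → ℂ} {t x : ℝ} (k : ℕ) (hx : x ∈ Set.Ioo 0 t) :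
    iteratedDeriv (k + 1) v x = deriv (iteratedDerivWithin k v (Set.Icc 0 t)) x := by
  rw [iteratedDeriv_succ]
  refine Filter.EventuallyEq.deriv_eq ?_
  filter_upwards [isOpen_Ioo.mem_nhds hx] with y hy
  exact (iteratedDerivWithin_Icc_eq_iteratedDeriv k hy).symm

/-- Repeated integration by parts. The last one needs only absolute continuity of the `n`-th
derivative, and the endpoints, where one-sided and two-sided derivatives may differ, do not affect
the remainder. -/
theorem taylor_integral_remainder_complex {v : ℝ → ℂ} {T t : ℝ} {n : ℕ} (ht : 0 < t) (htT : t ≤ T)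
    (hv : ContDiffOn ℝ n v (Set.Icc 0 T))
    (hac : AbsolutelyContinuousOnInterval (iteratedDerivWithin n v (Set.Icc 0 T)) 0 T) :
    v t = ∑ k ∈ Finset.range (n + 1),
        iteratedDerivWithin k v (Set.Icc 0 T) 0 / (k.factorial : ℂ) * (t : ℂ) ^ k +
      ∫ s in (0 : ℝ)..t, ((t - s) ^ n / n.factorial) • iteratedDeriv (n + 1) v s := by
  have hT := ht.trans_le htT
  have hvt : ContDiffOn ℝ n v (Set.uIcc 0 t) := by
    rw [Set.uIcc_of_le ht.le]
    exact hv.mono (Set.Icc_subset_Icc_right htT)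
  have h := taylor_integral_remainder_aux (f := v) (x := t) (x₀ := 0) (n := n) (by
    intro k hk
    refine integral_smul_deriv_eq_deriv_smul
      (u := fun s => (t - s) ^ k / k.factorial) ?_ ?_
    · apply ContDiffOn.absolutelyContinuousOnInterval
      fun_prop
    -- For `k = n` absolute continuity is `hac` restricted to `[0, t]`; for `k < n` the derivative
    -- is `C^1`.
    · rcases hk.eq_or_lt with rfl | hk
      · refine absolutelyContinuousOnInterval_of_dist_le (hac.mono (c := 0) (d := t) ?_) ?_
        · rw [Set.uIcc_of_le ht.le, Set.uIcc_of_le hT.le]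
          exact Set.Icc_subset_Icc_right htT
        · rw [Set.uIcc_of_le ht.le]
          intro x hx y hy
          rw [iteratedDerivWithin_Icc_eq ht htT hv le_rfl hx,
            iteratedDerivWithin_Icc_eq ht htT hv le_rfl hy]
      replace hvt := hvt.of_le (m := k.succ) (by norm_cast)
      grind [ContDiffOn.absolutelyContinuousOnInterval, uniqueDiffOn_uIcc,
        contDiffOn_nat_succ_iff_contDiffOn_one_iteratedDerivWithin])
  rw [sub_eq_iff_eq_add, add_comm, taylor_within_apply] at h
  rw [h]
  congr 1
  · refine Finset.sum_congr rfl fun k hk => ?_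
    rw [Set.uIcc_of_le ht.le, iteratedDerivWithin_Icc_eq ht htT hv
      (Nat.lt_succ_iff.1 (Finset.mem_range.1 hk)) ⟨le_rfl, ht.le⟩, Complex.real_smul]
    push_cast
    rw [sub_zero]
    ring
  · refine intervalIntegral.integral_congr_uIoo fun s hs => ?_
    rw [Set.uIcc_of_le ht.le]
    rw [Set.uIoo_of_le ht.le] at hs
    rw [iteratedDerivWithin_Icc_eq_iteratedDeriv _ hs]

theorem integrableOn_iteratedDeriv {v : ℝ → ℂ} {T : ℝ} {n : ℕ}
    (hac : AbsolutelyContinuousOnInterval (iteratedDerivWithin n v (Set.Icc 0 T)) 0 T) :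
    IntegrableOn (iteratedDeriv (n + 1) v) (Set.Ioc 0 T) := by
  have h := (intervalIntegrable_deriv hac).1
  rw [integrableOn_Ioc_iff_integrableOn_Ioo] at h ⊢
  exact h.congr_fun (fun x hx => (iteratedDeriv_succ_eq_deriv n hx).symm) measurableSet_Ioo

/-- With `N = ⌈θ⌉`, `I^θ I^(N-θ) ∂^N v = I^N ∂^N v`, which is the Taylor remainder because `Γ(N) =
(N-1)!`. Non-integrality gives `N - θ > 0`, as the semigroup law requires. -/
theorem eq_sum_add_rlIntegral_caputoDeriv {θ T t : ℝ} (hθ : 0 < θ) (hθc : θ < ⌈θ⌉₊) {v : ℝ → ℂ}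
    (ht : t ∈ Set.Icc 0 T)
    (hv : ContDiffOn ℝ ((⌈θ⌉₊ - 1 : ℕ) : ℕ∞) v (Set.Icc 0 T))
    (hac : AbsolutelyContinuousOnInterval
      (iteratedDerivWithin (⌈θ⌉₊ - 1) v (Set.Icc 0 T)) 0 T) :
    v t = ∑ k ∈ Finset.range ⌈θ⌉₊,
        iteratedDerivWithin k v (Set.Icc 0 T) 0 / (k.factorial : ℂ) * (t : ℂ) ^ k +
      rlIntegral θ (caputoDeriv θ v) t := by
  obtain ⟨n, hn⟩ : ∃ n, ⌈θ⌉₊ = n + 1 := Nat.exists_eq_succ_of_ne_zero (Nat.ceil_pos.2 hθ).ne'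
  rcases ht.1.eq_or_lt with rfl | ht0
  · rw [hn, Finset.sum_range_succ']
    simp [rlIntegral]
  have hcap : caputoDeriv θ v = rlIntegral ((⌈θ⌉₊ : ℝ) - θ) (iteratedDeriv ⌈θ⌉₊ v) := rfl
  rw [hcap, rlIntegral_rlIntegral hθ (sub_pos.2 hθc) ?_ ht0 ?_]
  · simp only [hn, Nat.add_sub_cancel] at hv hac ⊢
    rw [taylor_integral_remainder_complex ht0 ht.2 hv hac]
    congr 1
    rw [rlIntegral, ← intervalIntegral.integral_const_mul]
    refine intervalIntegral.integral_congr fun s _ => ?_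
    have e : θ + (((n + 1 : ℕ) : ℝ) - θ) = n + 1 := by push_cast; ring
    rw [e, Real.Gamma_nat_eq_factorial, add_sub_cancel_right, Real.rpow_natCast, Complex.real_smul]
    push_cast
    ring
  · rw [hn]
    push_cast
    linarith [(Nat.cast_nonneg n : (0 : ℝ) ≤ n)]
  · simp only [hn, Nat.add_sub_cancel] at hac ⊢
    exact (integrableOn_iteratedDeriv hac).mono_set (Set.Ioc_subset_Ioc_right ht.2)

/-- The differential equation holds only almost everywhere, but the integral does not see null sets,
so the integral equation holds at every `t`. -/
theorem IsSolution.eq_psi_add_rlIntegral {n : ℕ} {θ : Fin n → ℝ} {T : ℝ} {v0 : Fin n → ℕ → ℂ}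
    {p : Fin n → Fin (n + 1) → ℝ → ℂ} {v : Fin n → ℝ → ℂ} (hv : IsSolution θ T v0 p v)
    {j : Fin n} (hθ : 0 < θ j) (hθc : θ j < ⌈θ j⌉₊) {t : ℝ} (ht : t ∈ Set.Icc 0 T) :
    v j t = psi (θ j) (v0 j) t + rlIntegral (θ j)
      (fun s => (∑ r : Fin n, p j r.castSucc s * v r s) + p j (Fin.last n) s) t := by
  rw [eq_sum_add_rlIntegral_caputoDeriv hθ hθc ht (hv.contDiffOn j) (hv.absCont j)]
  congr 1
  · exact Finset.sum_congr rfl fun k hk => by rw [hv.initial j k (Finset.mem_range.1 hk)]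
  · exact rlIntegral_congr_ae ht.1
      (ae_mono (Measure.restrict_mono (Set.Icc_subset_Icc_right ht.2) le_rfl) (hv.equation j))

/-! ### Arithmetic of the orders and of the indices `θ_j q`. -/

theorem lcmDen_pos {n : ℕ} {d : Fin n → ℕ} (hd : ∀ j, 2 ≤ d j) : 0 < lcmDen d := by
  refine Nat.pos_of_ne_zero fun h => ?_
  obtain ⟨j, -, hj⟩ := Finset.lcm_eq_zero_iff.1 h
  have := hd j
  omega

theorem dvd_lcmDen {n : ℕ} (d : Fin n → ℕ) (j : Fin n) : d j ∣ lcmDen d :=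
  Finset.dvd_lcm (Finset.mem_univ j)

theorem startIndex_pos {n : ℕ} {γ d : Fin n → ℕ} (hγ : ∀ j, 1 ≤ γ j) (hd : ∀ j, 2 ≤ d j)
    (j : Fin n) : 0 < startIndex γ d j :=
  Nat.mul_pos (hγ j) (Nat.div_pos (Nat.le_of_dvd (lcmDen_pos hd) (dvd_lcmDen d j))
    (by have := hd j; omega))

theorem startIndex_eq {n : ℕ} (γ : Fin n → ℕ) {d : Fin n → ℕ} (hd : ∀ j, 2 ≤ d j) (j : Fin n) :
    (startIndex γ d j : ℝ) = order γ d j * lcmDen d := by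
  have h : (d j : ℝ) ≠ 0 := by
    have := hd j
    exact_mod_cast (by omega : d j ≠ 0)
  rw [startIndex, order, Nat.cast_mul, Nat.cast_div (dvd_lcmDen d j) h]
  ring

theorem order_pos {n : ℕ} {γ d : Fin n → ℕ} (hγ : ∀ j, 1 ≤ γ j) (hd : ∀ j, 2 ≤ d j) (j : Fin n) :
    0 < order γ d j := by
  have h1 : (0 : ℝ) < γ j := by exact_mod_cast hγ j
  have h2 : (0 : ℝ) < d j := by exact_mod_cast (by have := hd j; omega : 0 < d j)
  exact div_pos h1 h2

theorem order_ne_natCast {n : ℕ} {γ d : Fin n → ℕ} (hd : ∀ j, 2 ≤ d j)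
    (hco : ∀ j, Nat.Coprime (γ j) (d j)) (j : Fin n) (N : ℕ) : order γ d j ≠ N := by
  intro h
  have h2 : (d j : ℝ) ≠ 0 := by
    have := hd j
    exact_mod_cast (by omega : d j ≠ 0)
  rw [order, div_eq_iff h2] at h
  have h3 : γ j = N * d j := by exact_mod_cast h
  have h4 := Nat.Coprime.eq_one_of_dvd (hco j).symm (h3 ▸ Dvd.intro_left N rfl)
  have := hd j
  omega

theorem order_lt_ceil {n : ℕ} {γ d : Fin n → ℕ} (hd : ∀ j, 2 ≤ d j)
    (hco : ∀ j, Nat.Coprime (γ j) (d j)) (j : Fin n) :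
    order γ d j < (⌈order γ d j⌉₊ : ℝ) :=
  lt_of_le_of_ne (Nat.le_ceil _) (order_ne_natCast hd hco j _)

/-! ### The recursion for the polynomials `G`. -/

open Polynomial in
/-- The polynomials `G_{j,m}`, defined by their recursion. -/
def solPoly {n : ℕ} (γ d : Fin n → ℕ) (c : Fin n → Fin (n + 1) → ℕ → ℂ) (v0 : Fin n → ℕ → ℂ) :
    ℕ → Fin n → ℂ[X]
  | m => fun j => ∑ k ∈ Finset.range (m + 1),
      if lcmDen d * k ≤ m then
        C (xi γ d j (m + startIndex γ d j) : ℂ) *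
          ((∑ r : Fin n, ∑ ν ∈ Finset.range (m - lcmDen d * k + 1),
            C (c j r.castSucc (m - lcmDen d * k - ν)) *
              (if ν < startIndex γ d r then
                C (if lcmDen d ∣ ν then
                  v0 r (ν / lcmDen d) / ((ν / lcmDen d).factorial : ℂ) else 0)
              -- This test only serves termination: `ν ≤ m` and `startIndex γ d r > 0` make it
              -- always true, so the value `0` is never taken.
              else if _h : ν - startIndex γ d r < m then
                solPoly γ d c v0 (ν - startIndex γ d r) r
              else 0))
            + C (c j (Fin.last n) (m - lcmDen d * k))) * X ^ k * C ((k.factorial : ℂ)⁻¹)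
      else 0
  termination_by m => m

open Polynomial in
/-- The full coefficient sequence of the solution as polynomials in `iω`. -/
def vbarPoly {n : ℕ} (γ d : Fin n → ℕ) (c : Fin n → Fin (n + 1) → ℕ → ℂ) (v0 : Fin n → ℕ → ℂ)
    (r : Fin n) (ν : ℕ) : ℂ[X] :=
  if ν < startIndex γ d r then
    C (if lcmDen d ∣ ν then v0 r (ν / lcmDen d) / ((ν / lcmDen d).factorial : ℂ) else 0)
  else solPoly γ d c v0 (ν - startIndex γ d r) r

open Polynomial in
theorem solPoly_eq {n : ℕ} {γ d : Fin n → ℕ} (hγ : ∀ j, 1 ≤ γ j) (hd : ∀ j, 2 ≤ d j)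
    (c : Fin n → Fin (n + 1) → ℕ → ℂ) (v0 : Fin n → ℕ → ℂ) (m : ℕ) (j : Fin n) :
    solPoly γ d c v0 m j = ∑ k ∈ Finset.range (m + 1),
      if lcmDen d * k ≤ m then
        C (xi γ d j (m + startIndex γ d j) : ℂ) *
          ((∑ r : Fin n, ∑ ν ∈ Finset.range (m - lcmDen d * k + 1),
            C (c j r.castSucc (m - lcmDen d * k - ν)) * vbarPoly γ d c v0 r ν)
            + C (c j (Fin.last n) (m - lcmDen d * k))) * X ^ k * C ((k.factorial : ℂ)⁻¹)
      else 0 := by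
  rw [solPoly]
  refine Finset.sum_congr rfl fun k _ => ?_
  split_ifs with hk
  · congr 4
    refine Finset.sum_congr rfl fun r _ => Finset.sum_congr rfl fun ν hν => ?_
    rw [vbarPoly]
    have h1 := startIndex_pos hγ hd r
    have h2 := Finset.mem_range.1 hν
    split_ifs with h3 h4 h5
    · rfl
    · rfl
    · rfl
    · exact absurd (by omega) h5
  · rfl

-- The factor `X^k` comes with coefficients of index at most `m - qk ≤ m - k`, so degrees add up to
-- at most `m`. Hence the coefficients up to `m` determine the polynomial.
open Polynomial in
theorem natDegree_solPoly_le {n : ℕ} {γ d : Fin n → ℕ} (hγ : ∀ j, 1 ≤ γ j) (hd : ∀ j, 2 ≤ d j)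
    (c : Fin n → Fin (n + 1) → ℕ → ℂ) (v0 : Fin n → ℕ → ℂ) (m : ℕ) :
    ∀ j, (solPoly γ d c v0 m j).natDegree ≤ m := by
  induction m using Nat.strong_induction_on with
  | _ m ih =>
    intro j
    rw [solPoly_eq hγ hd]
    refine natDegree_sum_le_of_forall_le _ _ fun k _ => ?_
    split_ifs with hk
    · have hq : k ≤ lcmDen d * k := Nat.le_mul_of_pos_left _ (lcmDen_pos hd)
      have hin : ((∑ r : Fin n, ∑ ν ∈ Finset.range (m - lcmDen d * k + 1),
            C (c j r.castSucc (m - lcmDen d * k - ν)) * vbarPoly γ d c v0 r ν)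
            + C (c j (Fin.last n) (m - lcmDen d * k))).natDegree ≤ m - k := by
        refine natDegree_add_le_of_degree_le ?_ (by simp)
        refine natDegree_sum_le_of_forall_le _ _ fun r _ =>
          natDegree_sum_le_of_forall_le _ _ fun ν hν => ?_
        refine (natDegree_C_mul_le _ _).trans ?_
        have h1 := startIndex_pos hγ hd r
        have h2 := Finset.mem_range.1 hν
        rw [vbarPoly]
        split_ifs
        · simp
        · simp
        · exact (ih _ (by omega) r).trans (by omega)
      refine (natDegree_mul_C_le _ _).trans ?_
      refine natDegree_mul_le.trans ?_
      rw [natDegree_X_pow]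
      have := (natDegree_C_mul_le (xi γ d j (m + startIndex γ d j) : ℂ) _).trans hin
      omega
    · simp

/-- The coefficients `a_{j,m,k}` of the polynomials `G_{j,m}`. -/
def solCoeff {n : ℕ} (γ d : Fin n → ℕ) (c : Fin n → Fin (n + 1) → ℕ → ℂ) (v0 : Fin n → ℕ → ℂ)
    (j : Fin n) (m k : ℕ) : ℂ :=
  (k.factorial : ℂ) * (solPoly γ d c v0 m j).coeff k

theorem G_solCoeff {n : ℕ} {γ d : Fin n → ℕ} (hγ : ∀ j, 1 ≤ γ j) (hd : ∀ j, 2 ≤ d j)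
    (c : Fin n → Fin (n + 1) → ℕ → ℂ) (v0 : Fin n → ℕ → ℂ) (j : Fin n) (m : ℕ) (z : ℂ) :
    G (solCoeff γ d c v0) j m z = (solPoly γ d c v0 m j).eval z := by
  rw [Polynomial.eval_eq_sum_range' (Nat.lt_succ_of_le (natDegree_solPoly_le hγ hd c v0 m j)), G]
  refine Finset.sum_congr rfl fun k _ => ?_
  have : (k.factorial : ℂ) ≠ 0 := by exact_mod_cast k.factorial_ne_zero
  rw [solCoeff]
  field_simp

theorem eval_vbarPoly {n : ℕ} {γ d : Fin n → ℕ} (hγ : ∀ j, 1 ≤ γ j) (hd : ∀ j, 2 ≤ d j)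
    (c : Fin n → Fin (n + 1) → ℕ → ℂ) (v0 : Fin n → ℕ → ℂ) (r : Fin n) (ν : ℕ) (z : ℂ) :
    (vbarPoly γ d c v0 r ν).eval z = vbar γ d v0 (solCoeff γ d c v0) z r ν := by
  rw [vbarPoly, vbar, G_solCoeff hγ hd]
  split_ifs <;> simp

theorem G_solCoeff_eq_sum {n : ℕ} {γ d : Fin n → ℕ} (hγ : ∀ j, 1 ≤ γ j) (hd : ∀ j, 2 ≤ d j)
    (c : Fin n → Fin (n + 1) → ℕ → ℂ) (v0 : Fin n → ℕ → ℂ) (j : Fin n) (m : ℕ) (z : ℂ) :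
    G (solCoeff γ d c v0) j m z = ∑ k ∈ Finset.range (m + 1),
      recCoeff γ d c (vbar γ d v0 (solCoeff γ d c v0) z) j m k * z ^ k / (k.factorial : ℂ) := by
  rw [G_solCoeff hγ hd, solPoly_eq hγ hd, Polynomial.eval_finsetSum]
  refine Finset.sum_congr rfl fun k _ => ?_
  rw [recCoeff]
  split_ifs
  · simp only [Polynomial.eval_mul, Polynomial.eval_add, Polynomial.eval_C, Polynomial.eval_pow,
      Polynomial.eval_X, Polynomial.eval_finsetSum, eval_vbarPoly hγ hd, div_eq_mul_inv]
  · simp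

/-! ### Power series in `s = t^(1/q)`: products, growth of coefficients, convergence. -/

/-- Both `e^(zt)` and `ψ` contain only powers `s^(qk)`; this passes from the index in `s` to `k`. -/
theorem sum_range_dvd {q N N' : ℕ} (hq : 0 < q) (h : ∀ k, q * k < N → k < N') (g : ℕ → ℕ → ℂ) :
    ∑ i ∈ Finset.range N, (if q ∣ i then g (i / q) i else 0) =
      ∑ k ∈ Finset.range N', if q * k < N then g k (q * k) else 0 := by
  rw [← Finset.sum_filter, ← Finset.sum_filter]
  refine Finset.sum_nbij' (fun i => i / q) (fun k => q * k) ?_ ?_ ?_ ?_ ?_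
  · intro i hi
    simp only [Finset.mem_filter, Finset.mem_range] at hi ⊢
    rw [Nat.mul_div_cancel' hi.2]
    exact ⟨h _ (by rw [Nat.mul_div_cancel' hi.2]; exact hi.1), hi.1⟩
  · intro k hk
    simp only [Finset.mem_filter, Finset.mem_range] at hk ⊢
    exact ⟨hk.2, Dvd.intro k rfl⟩
  · intro i hi
    exact Nat.mul_div_cancel' (Finset.mem_filter.1 hi).2
  · intro k _
    exact Nat.mul_div_cancel_left k hq
  · intro i hi
    simp only [Nat.mul_div_cancel' (Finset.mem_filter.1 hi).2]

/-- Since `A ≤ R/2`, the geometric sum costs a factor `2` independent of `m`. Only `y i` with `i ≤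
m` are bounded in advance, so the estimate can be used inside an induction. -/
theorem norm_sum_range_mul_le {x y : ℕ → ℂ} {M A K R : ℝ} (hM : 0 ≤ M) (hA : 0 ≤ A) (hK : 0 ≤ K)
    (hAR : 2 * A ≤ R) (m : ℕ) (hx : ∀ i, ‖x i‖ ≤ M * A ^ i) (hy : ∀ i ≤ m, ‖y i‖ ≤ K * R ^ i) :
    ‖∑ i ∈ Finset.range (m + 1), x (m - i) * y i‖ ≤ 2 * M * K * R ^ m := by
  have hR : 0 ≤ R := by linarith
  have hgeom : ∀ m : ℕ, ∑ i ∈ Finset.range (m + 1), A ^ (m - i) * R ^ i ≤ 2 * R ^ m := by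
    intro m
    induction m with
    | zero => norm_num
    | succ m ih =>
      rw [Finset.sum_range_succ]
      have e : ∑ i ∈ Finset.range (m + 1), A ^ (m + 1 - i) * R ^ i =
          A * ∑ i ∈ Finset.range (m + 1), A ^ (m - i) * R ^ i := by
        rw [Finset.mul_sum]
        refine Finset.sum_congr rfl fun i hi => ?_
        rw [Nat.succ_sub (Nat.lt_succ_iff.1 (Finset.mem_range.1 hi)), pow_succ]
        ring
      rw [e, Nat.sub_self, pow_zero, one_mul, pow_succ]
      have h1 := mul_le_mul_of_nonneg_left ih hA
      have h2 := mul_le_mul_of_nonneg_right hAR (pow_nonneg hR m)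
      nlinarith
  calc ‖∑ i ∈ Finset.range (m + 1), x (m - i) * y i‖
      ≤ ∑ i ∈ Finset.range (m + 1), (M * K) * (A ^ (m - i) * R ^ i) := by
        refine norm_sum_le_of_le _ fun i hi => ?_
        rw [norm_mul]
        refine (mul_le_mul (hx (m - i)) (hy i (Nat.lt_succ_iff.1 (Finset.mem_range.1 hi)))
          (norm_nonneg _) (mul_nonneg hM (pow_nonneg hA _))).trans (le_of_eq (by ring))
    _ = (M * K) * ∑ i ∈ Finset.range (m + 1), A ^ (m - i) * R ^ i := by rw [Finset.mul_sum]
    _ ≤ (M * K) * (2 * R ^ m) := mul_le_mul_of_nonneg_left (hgeom m) (mul_nonneg hM hK)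
    _ = 2 * M * K * R ^ m := by ring

theorem hasSum_cauchyProduct {x y : ℕ → ℂ} {s a b : ℂ} (hx : HasSum (fun i => x i * s ^ i) a)
    (hy : HasSum (fun i => y i * s ^ i) b) :
    HasSum (fun m => (∑ i ∈ Finset.range (m + 1), x (m - i) * y i) * s ^ m) (a * b) := by
  have h := hasSum_sum_range_mul_of_summable_norm hy.summable.norm hx.summable.norm
  rw [hx.tsum_eq, hy.tsum_eq, mul_comm] at h
  refine HasSum.congr_fun h fun m => ?_
  rw [Finset.sum_mul]
  refine Finset.sum_congr rfl fun i hi => ?_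
  rw [← Nat.sub_add_cancel (Nat.lt_succ_iff.1 (Finset.mem_range.1 hi)), pow_add,
    Nat.sub_add_cancel (Nat.lt_succ_iff.1 (Finset.mem_range.1 hi))]
  ring

/-- The coefficients of `e^(z s^q)` as a power series in `s`. -/
def expCoeff (q : ℕ) (z : ℂ) (i : ℕ) : ℂ :=
  if q ∣ i then z ^ (i / q) / ((i / q).factorial : ℂ) else 0

theorem norm_expCoeff_le (q : ℕ) (z : ℂ) {A : ℝ} (hA : 1 ≤ A) (i : ℕ) :
    ‖expCoeff q z i‖ ≤ Real.exp ‖z‖ * A ^ i := by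
  have h1 : ‖expCoeff q z i‖ ≤ Real.exp ‖z‖ := by
    rw [expCoeff]
    split_ifs
    · rw [norm_div, norm_pow, Complex.norm_natCast]
      exact Real.pow_div_factorial_le_exp _ (norm_nonneg z) _
    · simpa using (Real.exp_pos _).le
  exact h1.trans (le_mul_of_one_le_right (Real.exp_pos _).le (one_le_pow₀ hA))

theorem hasSum_expCoeff {q : ℕ} (hq : 0 < q) (z s : ℂ) :
    HasSum (fun i => expCoeff q z i * s ^ i) (Complex.exp (z * s ^ q)) := by
  have h := NormedSpace.expSeries_div_hasSum_exp (z * s ^ q)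
  rw [← Complex.exp_eq_exp_ℂ] at h
  have hinj : Function.Injective fun k : ℕ => q * k := fun a b hab =>
    Nat.eq_of_mul_eq_mul_left hq hab
  rw [← hinj.hasSum_iff]
  · refine h.congr_fun fun k => ?_
    simp only [Function.comp, expCoeff, dvd_mul_right, if_true, Nat.mul_div_cancel_left k hq]
    rw [mul_pow, pow_mul]
    ring
  · intro i hi
    rw [expCoeff, if_neg, zero_mul]
    rintro ⟨k, rfl⟩
    exact hi ⟨k, rfl⟩

/-- The coefficients of `∑_r f_{j,r} v_r + f_{j,n+1}` as a series in powers of `t^(1/q)`. -/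
def sourceCoeff {n : ℕ} (c : Fin n → Fin (n + 1) → ℕ → ℂ) (V : Fin n → ℕ → ℂ) (j : Fin n)
    (i : ℕ) : ℂ :=
  (∑ r : Fin n, ∑ ν ∈ Finset.range (i + 1), c j r.castSucc (i - ν) * V r ν) + c j (Fin.last n) i

/-- The coefficients of the right-hand sides `e^(zt) (∑_r f_{j,r} v_r + f_{j,n+1})`. -/
def rhsCoeff {n : ℕ} (q : ℕ) (c : Fin n → Fin (n + 1) → ℕ → ℂ) (z : ℂ) (V : Fin n → ℕ → ℂ)
    (j : Fin n) (m : ℕ) : ℂ :=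
  ∑ i ∈ Finset.range (m + 1), expCoeff q z (m - i) * sourceCoeff c V j i

/-- The recursion is a Cauchy product with the series of `e^(z s^q)`, whose coefficients vanish off
the multiples of `q`. -/
theorem sum_recCoeff {n : ℕ} {γ d : Fin n → ℕ} (hd : ∀ j, 2 ≤ d j)
    (c : Fin n → Fin (n + 1) → ℕ → ℂ) (V : Fin n → ℕ → ℂ) (j : Fin n) (m : ℕ) (z : ℂ) :
    ∑ k ∈ Finset.range (m + 1), recCoeff γ d c V j m k * z ^ k / (k.factorial : ℂ) =
      (xi γ d j (m + startIndex γ d j) : ℂ) * rhsCoeff (lcmDen d) c z V j m := by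
  have hq := lcmDen_pos hd
  have e1 : rhsCoeff (lcmDen d) c z V j m =
      ∑ i ∈ Finset.range (m + 1), expCoeff (lcmDen d) z i * sourceCoeff c V j (m - i) := by
    rw [rhsCoeff, ← Finset.sum_flip]
    refine Finset.sum_congr rfl fun i hi => ?_
    rw [Nat.sub_sub_self (Nat.lt_succ_iff.1 (Finset.mem_range.1 hi))]
  have e2 : ∀ i, expCoeff (lcmDen d) z i * sourceCoeff c V j (m - i) =
      if lcmDen d ∣ i then (fun k l => z ^ k / (k.factorial : ℂ) * sourceCoeff c V j (m - l))
        (i / lcmDen d) i else 0 := by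
    intro i
    rw [expCoeff]
    split_ifs <;> simp
  rw [e1, Finset.sum_congr rfl fun i _ => e2 i,
    sum_range_dvd hq (N' := m + 1) (fun k hk => (Nat.le_mul_of_pos_left k hq).trans_lt hk)
      (fun k l => z ^ k / (k.factorial : ℂ) * sourceCoeff c V j (m - l)),
    Finset.mul_sum]
  refine Finset.sum_congr rfl fun k _ => ?_
  simp only [recCoeff, sourceCoeff, Nat.lt_succ_iff]
  split_ifs
  · ring
  · simp

theorem norm_sourceCoeff_le {n : ℕ} {c : Fin n → Fin (n + 1) → ℕ → ℂ} {V : Fin n → ℕ → ℂ}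
    {M A K R : ℝ} (hM : 0 ≤ M) (hA : 0 ≤ A) (hK : 1 ≤ K) (hAR : 2 * A ≤ R)
    (hc : ∀ j r i, ‖c j r i‖ ≤ M * A ^ i) (j : Fin n) (m : ℕ)
    (hV : ∀ r, ∀ ν ≤ m, ‖V r ν‖ ≤ K * R ^ ν) :
    ‖sourceCoeff c V j m‖ ≤ ((2 * n + 1) * M * K) * R ^ m := by
  have hR : 0 ≤ R := by linarith
  have h1 : ‖∑ r : Fin n, ∑ ν ∈ Finset.range (m + 1), c j r.castSucc (m - ν) * V r ν‖ ≤
      ∑ _r : Fin n, 2 * M * K * R ^ m :=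
    norm_sum_le_of_le _ fun r _ =>
      norm_sum_range_mul_le hM hA (by linarith) hAR m (hc j r.castSucc) (hV r)
  -- `K ≥ 1` absorbs the inhomogeneous term into the same bound.
  have h2 : ‖c j (Fin.last n) m‖ ≤ M * K * R ^ m := by
    refine (hc j _ m).trans (mul_le_mul (le_mul_of_one_le_right hM hK)
      (pow_le_pow_left₀ hA (by linarith) m) (pow_nonneg hA m) (mul_nonneg hM (by linarith)))
  rw [Finset.sum_const, Finset.card_univ, Fintype.card_fin, nsmul_eq_mul] at h1
  refine (norm_add_le _ _).trans ((add_le_add h1 h2).trans (le_of_eq (by ring)))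

theorem norm_rhsCoeff_le {n : ℕ} (q : ℕ) {c : Fin n → Fin (n + 1) → ℕ → ℂ} (z : ℂ)
    {V : Fin n → ℕ → ℂ} {M A K R : ℝ} (hM : 0 ≤ M) (hA : 1 ≤ A) (hK : 1 ≤ K) (hAR : 2 * A ≤ R)
    (hc : ∀ j r i, ‖c j r i‖ ≤ M * A ^ i) (j : Fin n) (m : ℕ)
    (hV : ∀ r, ∀ ν ≤ m, ‖V r ν‖ ≤ K * R ^ ν) :
    ‖rhsCoeff q c z V j m‖ ≤ (2 * Real.exp ‖z‖ * ((2 * n + 1) * M * K)) * R ^ m := by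
  refine norm_sum_range_mul_le (Real.exp_pos _).le (by linarith) (by positivity) hAR m
    (norm_expCoeff_le q z hA) fun i hi => ?_
  exact norm_sourceCoeff_le hM (by linarith) hK hAR hc j i fun r ν hν => hV r ν (hν.trans hi)

/-- `K` dominates the finitely many starting coefficients. One step of the recursion multiplies the
bound `K R^m` by a constant independent of `m` and `K`; `R` is at least that constant, and the index
shift `S j ≥ 1` provides the extra power of `R` that pays for it. -/
theorem exists_geometric_bound {n : ℕ} (q : ℕ) {c : Fin n → Fin (n + 1) → ℕ → ℂ} (z : ℂ)
    {V : Fin n → ℕ → ℂ} {S : Fin n → ℕ} {x : Fin n → ℕ → ℂ} {M A X : ℝ} (hM : 0 ≤ M) (hA : 1 ≤ A)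
    (hX : 0 ≤ X) (hS : ∀ j, 0 < S j) (hx : ∀ j m, ‖x j m‖ ≤ X)
    (hc : ∀ j r i, ‖c j r i‖ ≤ M * A ^ i)
    (hV : ∀ j m, V j (m + S j) = x j m * rhsCoeff q c z V j m) :
    ∃ K R : ℝ, 1 ≤ K ∧ 2 * A ≤ R ∧ ∀ r ν, ‖V r ν‖ ≤ K * R ^ ν := by
  set K : ℝ := 1 + ∑ r : Fin n, ∑ ν ∈ Finset.range (S r), ‖V r ν‖ with hKdef
  set R : ℝ := max (2 * A) (X * (2 * Real.exp ‖z‖ * ((2 * n + 1) * M))) with hRdef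
  have hK : 1 ≤ K := le_add_of_nonneg_right
    (Finset.sum_nonneg fun _ _ => Finset.sum_nonneg fun _ _ => norm_nonneg _)
  have hAR : 2 * A ≤ R := le_max_left _ _
  have hR : 1 ≤ R := by linarith
  refine ⟨K, R, hK, hAR, fun r ν => ?_⟩
  induction ν using Nat.strong_induction_on generalizing r with
  | _ ν ih =>
    by_cases hν : ν < S r
    · have h1 : ‖V r ν‖ ≤ ∑ ν ∈ Finset.range (S r), ‖V r ν‖ :=
        Finset.single_le_sum (f := fun ν => ‖V r ν‖) (fun _ _ => norm_nonneg _)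
          (Finset.mem_range.2 hν)
      have h2 : ∑ ν ∈ Finset.range (S r), ‖V r ν‖ ≤
          ∑ r : Fin n, ∑ ν ∈ Finset.range (S r), ‖V r ν‖ :=
        Finset.single_le_sum (f := fun r => ∑ ν ∈ Finset.range (S r), ‖V r ν‖)
          (fun _ _ => Finset.sum_nonneg fun _ _ => norm_nonneg _) (Finset.mem_univ r)
      exact (by linarith : ‖V r ν‖ ≤ K).trans
        (le_mul_of_one_le_right (by linarith) (one_le_pow₀ hR))
    · obtain ⟨m, rfl⟩ := Nat.exists_eq_add_of_le' (not_lt.1 hν)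
      have hSr := hS r
      rw [hV, norm_mul]
      have h3 := norm_rhsCoeff_le q z hM hA hK hAR hc r m fun r' ν' hν' =>
        ih ν' (by omega) r'
      calc ‖x r m‖ * ‖rhsCoeff q c z V r m‖
          ≤ X * ((2 * Real.exp ‖z‖ * ((2 * n + 1) * M * K)) * R ^ m) :=
            mul_le_mul (hx r m) h3 (norm_nonneg _) hX
        _ = (X * (2 * Real.exp ‖z‖ * ((2 * n + 1) * M))) * (K * R ^ m) := by ring
        _ ≤ R * (K * R ^ m) :=
            mul_le_mul_of_nonneg_right (le_max_right _ _) (by positivity)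
        _ = K * R ^ (m + 1) := by rw [pow_succ]; ring
        _ ≤ K * R ^ (m + S r) := by
            gcongr
            exact hSr

theorem summable_of_geometric_bound {V : ℕ → ℂ} {K R s : ℝ} (hV : ∀ ν, ‖V ν‖ ≤ K * R ^ ν)
    (hR : 0 ≤ R) (hs : 0 ≤ s) (hRs : R * s ≤ 1 / 2) : Summable fun ν => ‖V ν‖ * s ^ ν := by
  have hK : 0 ≤ K := by simpa using (norm_nonneg _).trans (hV 0)
  refine Summable.of_nonneg_of_le (fun ν => by positivity) (fun ν => ?_)
    ((summable_geometric_of_lt_one (by norm_num) (by norm_num : (1 / 2 : ℝ) < 1)).mul_left K)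
  calc ‖V ν‖ * s ^ ν ≤ K * R ^ ν * s ^ ν := mul_le_mul_of_nonneg_right (hV ν) (by positivity)
    _ = K * (R * s) ^ ν := by rw [mul_pow, mul_assoc]
    _ ≤ K * (1 / 2) ^ ν := by gcongr

theorem hasSum_rhsCoeff {n q : ℕ} (hq : 0 < q) {c : Fin n → Fin (n + 1) → ℕ → ℂ} (z : ℂ)
    {V : Fin n → ℕ → ℂ} {s : ℂ} {φ : Fin n → Fin (n + 1) → ℂ} {W : Fin n → ℂ}
    (hφ : ∀ j r, HasSum (fun i => c j r i * s ^ i) (φ j r))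
    (hW : ∀ r, HasSum (fun ν => V r ν * s ^ ν) (W r)) (j : Fin n) :
    HasSum (fun m => rhsCoeff q c z V j m * s ^ m)
      (Complex.exp (z * s ^ q) * ((∑ r : Fin n, φ j r.castSucc * W r) + φ j (Fin.last n))) := by
  refine hasSum_cauchyProduct (hasSum_expCoeff hq z s) ?_
  have h := (hasSum_sum fun r (_ : r ∈ Finset.univ) =>
    hasSum_cauchyProduct (hφ j (Fin.castSucc r)) (hW r)).add (hφ j (Fin.last n))
  refine h.congr_fun fun i => ?_
  rw [sourceCoeff, add_mul, Finset.sum_mul]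

theorem rlIntegral_const_mul (α t : ℝ) (a : ℂ) (g : ℝ → ℂ) :
    rlIntegral α (fun s => a * g s) t = a * rlIntegral α g t := by
  simp only [rlIntegral, mul_left_comm _ a, intervalIntegral.integral_const_mul]

theorem ofReal_rpow_div {q : ℕ} {t : ℝ} (ht : 0 ≤ t) (i : ℕ) :
    ((t ^ ((i : ℝ) / (q : ℝ)) : ℝ) : ℂ) = ((t ^ (1 / (q : ℝ)) : ℝ) : ℂ) ^ i := by
  rw [← Complex.ofReal_pow, ← Real.rpow_mul_natCast ht, one_div_mul_eq_div]

theorem root_pow {q : ℕ} (hq : 0 < q) {t : ℝ} (ht : 0 ≤ t) : (t ^ (1 / (q : ℝ))) ^ q = t := by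
  rw [one_div]
  exact Real.rpow_inv_natCast_pow ht hq.ne'

theorem continuous_root (q : ℕ) : Continuous fun t : ℝ => t ^ (1 / (q : ℝ)) :=
  Real.continuous_rpow_const (by positivity)

/-! ### Expansion of the functions `f`. -/

/-- With `t = s^q` the factor `e^(-iωt)` is analytic in `s`, so removing the oscillation preserves
analyticity in `s`. -/
theorem eventually_hasSum_of_isAnalyticInRoot {q : ℕ} (hq : 0 < q) {p : ℝ → ℂ}
    (hp : IsAnalyticInRoot q p) (ω : ℝ) :
    ∃ c : ℕ → ℂ, ∀ᶠ t in 𝓝[≥] (0 : ℝ),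
      HasSum (fun i : ℕ => c i * ((t ^ ((i : ℝ) / (q : ℝ)) : ℝ) : ℂ))
        (p t * Complex.exp (-(Complex.I * ω * t))) := by
  obtain ⟨pbar, han, hev⟩ := hp
  have hexp : AnalyticAt ℝ (fun s : ℝ => Complex.exp (-(Complex.I * ω * (s : ℂ) ^ q))) 0 := by
    have h1 : AnalyticAt ℝ (fun s : ℝ => (s : ℂ)) 0 := Complex.ofRealCLM.analyticAt 0
    have h2 : AnalyticAt ℝ Complex.exp (-(Complex.I * ω * ((0 : ℝ) : ℂ) ^ q)) :=
      analyticAt_cexp.restrictScalars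
    exact AnalyticAt.comp (f := fun s : ℝ => -(Complex.I * ω * (s : ℂ) ^ q)) h2
      ((analyticAt_const.mul (h1.pow q)).neg)
  obtain ⟨ps, hps⟩ := han.mul hexp
  have hs := hasFPowerSeriesAt_iff.1 hps
  refine ⟨ps.coeff, ?_⟩
  have ht0 : Tendsto (fun t : ℝ => t ^ (1 / (q : ℝ))) (𝓝[≥] 0) (𝓝 0) := by
    have := (continuous_root q).tendsto 0
    rw [Real.zero_rpow (by positivity)] at this
    exact this.mono_left nhdsWithin_le_nhds
  filter_upwards [ht0.eventually hs, hev, self_mem_nhdsWithin] with t h1 h2 h3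
  have h3' : (0 : ℝ) ≤ t := h3
  simp only [zero_add, Pi.mul_apply] at h1
  rw [← h2, ← Complex.ofReal_pow, root_pow hq h3'] at h1
  refine HasSum.congr_fun h1 fun i => ?_
  rw [ofReal_rpow_div h3', Complex.real_smul, Complex.ofReal_pow, mul_comm]

theorem exists_coeff_of_oscCoeff {n : ℕ} {d : Fin n → ℕ} (hd : ∀ j, 2 ≤ d j)
    {f : Fin n → Fin (n + 1) → ℝ → ℂ} {ω : ℝ}
    (hana : ∀ j r, IsAnalyticInRoot (lcmDen d) (oscCoeff f ω j r)) :
    ∃ c : Fin n → Fin (n + 1) → ℕ → ℂ, ∃ δ : ℝ, 0 < δ ∧ ∀ j r, ∀ t ∈ Set.Icc 0 δ,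
      HasSum (fun i : ℕ => c j r i * ((t ^ ((i : ℝ) / (lcmDen d : ℝ)) : ℝ) : ℂ)) (f j r t) := by
  choose c hc using fun j r =>
    eventually_hasSum_of_isAnalyticInRoot (lcmDen_pos hd) (hana j r) ω
  have hall := eventually_all.2 fun j => eventually_all.2 fun r => hc j r
  obtain ⟨δ, hδ, h⟩ := (mem_nhdsGE_iff_exists_Icc_subset).1 hall
  refine ⟨c, δ, hδ, fun j r t ht => ?_⟩
  have h1 := h ht j r
  rwa [oscCoeff, mul_assoc, ← Complex.exp_add, add_neg_cancel, Complex.exp_zero, mul_one] at h1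

/-- The terms of a series convergent at `t = δ` are bounded there; hence the rate `δ^(-1/q)`,
enlarged to be at least `1`. -/
theorem exists_coeff_bound {n q : ℕ} {c : Fin n → Fin (n + 1) → ℕ → ℂ}
    {f : Fin n → Fin (n + 1) → ℝ → ℂ} {δ : ℝ} (hδ : 0 < δ)
    (hf : ∀ j r, ∀ t ∈ Set.Icc 0 δ,
      HasSum (fun i : ℕ => c j r i * ((t ^ ((i : ℝ) / (q : ℝ)) : ℝ) : ℂ)) (f j r t)) :
    ∃ M A : ℝ, 0 ≤ M ∧ 1 ≤ A ∧ ∀ j r i, ‖c j r i‖ ≤ M * A ^ i := by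
  set s : ℝ := δ ^ (1 / (q : ℝ)) with hs
  have hs0 : 0 < s := Real.rpow_pos_of_pos hδ _
  have h1 : ∀ j r, Summable fun i => ‖c j r i‖ * s ^ i := fun j r => by
    refine ((hf j r δ ⟨hδ.le, le_rfl⟩).summable.norm).congr fun i => ?_
    rw [ofReal_rpow_div hδ.le, norm_mul, norm_pow, Complex.norm_real, Real.norm_of_nonneg hs0.le]
  have hnn : ∀ j r i, 0 ≤ ‖c j r i‖ * s ^ i := fun j r i => by positivity
  refine ⟨∑ j, ∑ r, ∑' i, ‖c j r i‖ * s ^ i, max 1 s⁻¹,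
    Finset.sum_nonneg fun j _ => Finset.sum_nonneg fun r _ => tsum_nonneg (hnn j r),
    le_max_left _ _, fun j r i => ?_⟩
  have h2 : ‖c j r i‖ * s ^ i ≤ ∑ j, ∑ r, ∑' i, ‖c j r i‖ * s ^ i :=
    ((h1 j r).le_tsum i fun k _ => hnn j r k).trans
      ((Finset.single_le_sum (f := fun r => ∑' i, ‖c j r i‖ * s ^ i)
        (fun r _ => tsum_nonneg (hnn j r)) (Finset.mem_univ r)).trans
      (Finset.single_le_sum (f := fun j => ∑ r, ∑' i, ‖c j r i‖ * s ^ i)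
        (fun j _ => Finset.sum_nonneg fun r _ => tsum_nonneg (hnn j r)) (Finset.mem_univ j)))
  have h3 : ‖c j r i‖ = ‖c j r i‖ * s ^ i * s⁻¹ ^ i := by
    rw [mul_assoc, ← mul_pow, mul_inv_cancel₀ hs0.ne', one_pow, mul_one]
  rw [h3]
  exact mul_le_mul h2 (pow_le_pow_left₀ (by positivity) (le_max_right _ _) i) (by positivity)
    ((hnn j r i).trans h2)

/-! ### The series solution of the Volterra equation. -/

theorem xi_add_startIndex {n : ℕ} (γ : Fin n → ℕ) {d : Fin n → ℕ} (hd : ∀ j, 2 ≤ d j) (j : Fin n)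
    (m : ℕ) : xi γ d j (m + startIndex γ d j) =
      Real.Gamma ((m : ℝ) / lcmDen d + 1) / Real.Gamma ((m : ℝ) / lcmDen d + order γ d j + 1) := by
  have hq : (lcmDen d : ℝ) ≠ 0 := by exact_mod_cast (lcmDen_pos hd).ne'
  have e : ((m + startIndex γ d j : ℕ) : ℝ) / (lcmDen d : ℝ) = m / lcmDen d + order γ d j := by
    rw [Nat.cast_add, startIndex_eq γ hd]
    field_simp
  rw [xi, e, add_sub_cancel_right]

theorem vbar_add_startIndex {n : ℕ} (γ d : Fin n → ℕ) (v0 : Fin n → ℕ → ℂ)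
    (a : Fin n → ℕ → ℕ → ℂ) (z : ℂ) (j : Fin n) (m : ℕ) :
    vbar γ d v0 a z j (m + startIndex γ d j) = G a j m z := by
  rw [vbar, if_neg (by omega), Nat.add_sub_cancel]

/-- Among the indices below `θ_j q` only multiples `qk` contribute, and `qk < θ_j q` means `k <
⌈θ_j⌉`. -/
theorem sum_vbar_eq_psi {n : ℕ} {γ d : Fin n → ℕ} (hd : ∀ j, 2 ≤ d j)
    (v0 : Fin n → ℕ → ℂ) (a : Fin n → ℕ → ℕ → ℂ) (z : ℂ) (j : Fin n) {t : ℝ} (ht : 0 ≤ t) :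
    ∑ ν ∈ Finset.range (startIndex γ d j),
      vbar γ d v0 a z j ν * ((t ^ (1 / (lcmDen d : ℝ)) : ℝ) : ℂ) ^ ν =
      psi (order γ d j) (v0 j) t := by
  set q := lcmDen d with hqdef
  have hq : 0 < q := lcmDen_pos hd
  have hq' : (0 : ℝ) < q := by exact_mod_cast hq
  have hlt : ∀ k : ℕ, q * k < startIndex γ d j ↔ k < ⌈order γ d j⌉₊ := by
    intro k
    rw [Nat.lt_ceil, ← Nat.cast_lt (α := ℝ), startIndex_eq γ hd, Nat.cast_mul, mul_comm,
      mul_lt_mul_iff_left₀ hq']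
  have e : ∀ ν ∈ Finset.range (startIndex γ d j),
      vbar γ d v0 a z j ν * ((t ^ (1 / (q : ℝ)) : ℝ) : ℂ) ^ ν =
      if q ∣ ν then (fun k l => v0 j k / (k.factorial : ℂ) * ((t ^ (1 / (q : ℝ)) : ℝ) : ℂ) ^ l)
        (ν / q) ν else 0 := by
    intro ν hν
    rw [vbar, if_pos (Finset.mem_range.1 hν)]
    simp only [← hqdef]
    split_ifs <;> simp
  rw [Finset.sum_congr rfl e, sum_range_dvd hq (N' := ⌈order γ d j⌉₊) (fun k hk => (hlt k).1 hk)
    (fun k l => v0 j k / (k.factorial : ℂ) * ((t ^ (1 / (q : ℝ)) : ℝ) : ℂ) ^ l), psi]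
  refine Finset.sum_congr rfl fun k hk => ?_
  rw [if_pos ((hlt k).2 (Finset.mem_range.1 hk)), pow_mul, ← Complex.ofReal_pow, root_pow hq ht]

theorem exists_series_solution {n : ℕ} {γ d : Fin n → ℕ} (hγ : ∀ j, 1 ≤ γ j) (hd : ∀ j, 2 ≤ d j)
    (v0 : Fin n → ℕ → ℂ) {c : Fin n → Fin (n + 1) → ℕ → ℂ} {f : Fin n → Fin (n + 1) → ℝ → ℂ}
    {δ₀ : ℝ} (hδ₀ : 0 < δ₀)
    (hf : ∀ j r, ∀ t ∈ Set.Icc 0 δ₀,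
      HasSum (fun i : ℕ => c j r i * ((t ^ ((i : ℝ) / (lcmDen d : ℝ)) : ℝ) : ℂ)) (f j r t))
    (ω : ℝ) :
    ∃ δ : ℝ, 0 < δ ∧ ∃ W : Fin n → ℝ → ℂ, (∀ r, ContinuousOn (W r) (Set.Icc 0 δ)) ∧
      ∀ j, ∀ t ∈ Set.Icc 0 δ,
        HasSum (fun m : ℕ => G (solCoeff γ d c v0) j m (Complex.I * ω) *
          ((t ^ (((m + startIndex γ d j : ℕ) : ℝ) / (lcmDen d : ℝ)) : ℝ) : ℂ))
          (rlIntegral (order γ d j) (fun s => (∑ r : Fin n, oscCoeff f ω j r.castSucc s * W r s) +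
            oscCoeff f ω j (Fin.last n) s) t) ∧
        W j t = psi (order γ d j) (v0 j) t +
          rlIntegral (order γ d j) (fun s => (∑ r : Fin n, oscCoeff f ω j r.castSucc s * W r s) +
            oscCoeff f ω j (Fin.last n) s) t := by
  set q := lcmDen d with hqdef
  set z : ℂ := Complex.I * ω with hz
  set V : Fin n → ℕ → ℂ := vbar γ d v0 (solCoeff γ d c v0) z with hVdef
  have hq : 0 < q := lcmDen_pos hd
  have hG : ∀ j m, G (solCoeff γ d c v0) j m z =
      (xi γ d j (m + startIndex γ d j) : ℂ) * rhsCoeff q c z V j m := fun j m => by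
    rw [G_solCoeff_eq_sum hγ hd, sum_recCoeff hd]
  have hVs : ∀ j m, V j (m + startIndex γ d j) =
      (xi γ d j (m + startIndex γ d j) : ℂ) * rhsCoeff q c z V j m := fun j m => by
    rw [← hG, hVdef, vbar_add_startIndex]
  obtain ⟨M, A, hM, hA, hcb⟩ := exists_coeff_bound hδ₀ hf
  have hGamma : ∀ j, 0 < Real.Gamma (order γ d j + 1) := fun j =>
    Real.Gamma_pos_of_pos (by have := order_pos hγ hd j; linarith)
  have hxi : ∀ j m, ‖(xi γ d j (m + startIndex γ d j) : ℂ)‖ ≤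
      ∑ j, 1 / Real.Gamma (order γ d j + 1) := by
    intro j m
    have h1 : (0 : ℝ) ≤ (m : ℝ) / q := by positivity
    have h2 := order_pos hγ hd j
    have h3 := Real.Gamma_pos_of_pos (by positivity : (0 : ℝ) < (m : ℝ) / q + 1)
    have h4 := Real.Gamma_pos_of_pos (by positivity : (0 : ℝ) < (m : ℝ) / q + order γ d j + 1)
    rw [Complex.norm_real, xi_add_startIndex γ hd, Real.norm_of_nonneg (by positivity)]
    exact (Gamma_div_Gamma_le h2 h1).trans
      (Finset.single_le_sum (f := fun j => 1 / Real.Gamma (order γ d j + 1))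
        (fun j _ => one_div_nonneg.2 (hGamma j).le) (Finset.mem_univ j))
  obtain ⟨K, R, hK, hAR, hVb⟩ := exists_geometric_bound q z
    (x := fun j m => (xi γ d j (m + startIndex γ d j) : ℂ)) hM hA
    (Finset.sum_nonneg fun j _ => one_div_nonneg.2 (hGamma j).le) (startIndex_pos hγ hd) hxi hcb hVs
  have hR : 0 < R := by linarith
  -- At `s₁` the majorant `K (R s)^ν` is geometric of ratio `1/2`; in terms of `t` the radius is
  -- `s₁^q`.
  set s₁ : ℝ := 1 / (2 * R) with hs₁
  have hs₁0 : 0 < s₁ := by positivity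
  have hRs : R * s₁ ≤ 1 / 2 := le_of_eq (by rw [hs₁]; field_simp)
  have hroot : ∀ t, 0 ≤ t → t ≤ s₁ ^ q → t ^ (1 / (q : ℝ)) ≤ s₁ := by
    intro t ht hts
    have h := Real.rpow_le_rpow ht hts (by positivity : (0 : ℝ) ≤ 1 / (q : ℝ))
    rwa [one_div, Real.pow_rpow_inv_natCast hs₁0.le hq.ne', ← one_div] at h
  have hVsum : ∀ r, Summable fun ν => ‖V r ν‖ * s₁ ^ ν := fun r =>
    summable_of_geometric_bound (hVb r) hR.le hs₁0.le hRs
  have hHsum : ∀ j, Summable fun m => ‖rhsCoeff q c z V j m‖ * s₁ ^ m := fun j =>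
    summable_of_geometric_bound
      (fun m => norm_rhsCoeff_le q z hM hA hK hAR hcb j m fun r ν _ => hVb r ν) hR.le hs₁0.le hRs
  have hnorm : ∀ (x : ℂ) (ν : ℕ) (t : ℝ), 0 ≤ t → t ≤ s₁ ^ q →
      ‖x * ((t ^ (1 / (q : ℝ)) : ℝ) : ℂ) ^ ν‖ ≤ ‖x‖ * s₁ ^ ν := by
    intro x ν t ht hts
    rw [norm_mul, norm_pow, Complex.norm_real, Real.norm_of_nonneg (Real.rpow_nonneg ht _)]
    exact mul_le_mul_of_nonneg_left
      (pow_le_pow_left₀ (Real.rpow_nonneg ht _) (hroot t ht hts) ν) (norm_nonneg _)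
  set W : Fin n → ℝ → ℂ := fun r t => ∑' ν, V r ν * ((t ^ (1 / (q : ℝ)) : ℝ) : ℂ) ^ ν with hW
  have hterm : ∀ (x : ℂ) (ν : ℕ), Continuous fun t : ℝ => x * ((t ^ (1 / (q : ℝ)) : ℝ) : ℂ) ^ ν :=
    fun x ν => continuous_const.mul ((Complex.continuous_ofReal.comp (continuous_root q)).pow ν)
  have hWsum : ∀ r t, 0 ≤ t → t ≤ s₁ ^ q →
      HasSum (fun ν => V r ν * ((t ^ (1 / (q : ℝ)) : ℝ) : ℂ) ^ ν) (W r t) := fun r t ht hts =>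
    ((hVsum r).of_norm_bounded fun ν => hnorm _ ν t ht hts).hasSum
  refine ⟨min δ₀ (s₁ ^ q), lt_min hδ₀ (by positivity), W, fun r => ?_, fun j t ht => ?_⟩
  · exact continuousOn_tsum (fun ν => (hterm (V r ν) ν).continuousOn) (hVsum r)
      fun ν t ht => hnorm _ ν t ht.1 (ht.2.trans (min_le_right _ _))
  · have hθ := order_pos hγ hd j
    have h1 : HasSum (fun m => rlIntegral (order γ d j)
        (fun s => rhsCoeff q c z V j m * ((s ^ (1 / (q : ℝ)) : ℝ) : ℂ) ^ m) t)
        (rlIntegral (order γ d j) (fun s => (∑ r : Fin n, oscCoeff f ω j r.castSucc s * W r s) +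
            oscCoeff f ω j (Fin.last n) s) t) := by
      refine hasSum_rlIntegral hθ ht.1 (hHsum j) (fun m => (hterm _ m).continuousOn)
        (fun m s hs => hnorm _ m s hs.1 ((hs.2.trans ht.2).trans (min_le_right _ _)))
        fun s hs => ?_
      have hs' := hs.2.trans ht.2
      have h2 := hasSum_rhsCoeff hq (c := c) z (V := V) (s := ((s ^ (1 / (q : ℝ)) : ℝ) : ℂ))
        (φ := fun j r => f j r s) (W := fun r => W r s)
        (fun j r => HasSum.congr_fun (hf j r s ⟨hs.1, hs'.trans (min_le_left _ _)⟩) fun i => by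
          rw [ofReal_rpow_div hs.1])
        (fun r => hWsum r s hs.1 (hs'.trans (min_le_right _ _))) j
      rw [← Complex.ofReal_pow, root_pow hq hs.1] at h2
      convert h2 using 1
      simp only [oscCoeff, mul_add, Finset.mul_sum, ← hz]
      congr 1
      · exact Finset.sum_congr rfl fun r _ => by ring
      · ring
    -- Integrating `rhsCoeff m * t^(m/q)` multiplies it by `xi` and raises the exponent by `θ_j`:
    -- this is the recursion.
    have h3 : HasSum (fun m : ℕ => G (solCoeff γ d c v0) j m z *
          ((t ^ (((m + startIndex γ d j : ℕ) : ℝ) / (q : ℝ)) : ℝ) : ℂ))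
          (rlIntegral (order γ d j) (fun s => (∑ r : Fin n, oscCoeff f ω j r.castSucc s * W r s) +
            oscCoeff f ω j (Fin.last n) s) t) := by
      refine HasSum.congr_fun h1 fun m => ?_
      have h4 : rlIntegral (order γ d j)
          (fun s => rhsCoeff q c z V j m * ((s ^ (1 / (q : ℝ)) : ℝ) : ℂ) ^ m) t =
          rlIntegral (order γ d j)
          (fun s => rhsCoeff q c z V j m * ((s ^ ((m : ℝ) / (q : ℝ)) : ℝ) : ℂ)) t :=
        rlIntegral_congr ht.1 fun s hs => by rw [ofReal_rpow_div hs.1]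
      have hq' : (q : ℝ) ≠ 0 := by exact_mod_cast hq.ne'
      have e : ((m + startIndex γ d j : ℕ) : ℝ) / (q : ℝ) = m / q + order γ d j := by
        rw [Nat.cast_add, startIndex_eq γ hd, ← hqdef]
        field_simp
      rw [h4, rlIntegral_const_mul, rlIntegral_rpow hθ (by positivity) ht.1, hG,
        xi_add_startIndex γ hd, e]
      push_cast
      ring
    refine ⟨h3, ?_⟩
    -- Removing the terms below `θ_j q`, which sum to `ψ_j`, leaves the series already identified
    -- with the integral.
    have h5 := (hasSum_nat_add_iff' (startIndex γ d j)).2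
      (hWsum j t ht.1 (ht.2.trans (min_le_right _ _)))
    rw [hVdef, sum_vbar_eq_psi hd v0 _ z j ht.1] at h5
    have h6 := h5.unique (HasSum.congr_fun h3 fun m => by
      rw [vbar_add_startIndex, ofReal_rpow_div ht.1])
    rw [← h6]
    ring

/-! ### Uniqueness on a short interval, and the conclusion. -/

theorem eq_zero_of_halving {n : ℕ} {u : Fin n → ℝ → ℂ} {δ : ℝ}
    (hu : ∀ r, ContinuousOn (u r) (Set.Icc 0 δ))
    (h : ∀ U : ℝ, 0 ≤ U → (∀ r, ∀ t ∈ Set.Icc 0 δ, ‖u r t‖ ≤ U) →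
      ∀ r, ∀ t ∈ Set.Icc 0 δ, ‖u r t‖ ≤ U / 2) :
    ∀ r, ∀ t ∈ Set.Icc 0 δ, u r t = 0 := by
  choose B hB using fun r => isCompact_Icc.exists_bound_of_continuousOn (hu r)
  have hk : ∀ k : ℕ, ∀ r, ∀ t ∈ Set.Icc 0 δ, ‖u r t‖ ≤ (∑ r, |B r|) * (1 / 2) ^ k := by
    intro k
    induction k with
    | zero =>
      intro r t ht
      rw [pow_zero, mul_one]
      exact (hB r t ht).trans ((le_abs_self _).trans
        (Finset.single_le_sum (f := fun r => |B r|) (fun _ _ => abs_nonneg _)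
          (Finset.mem_univ r)))
    | succ k ih =>
      intro r t ht
      refine (h _ (by positivity) ih r t ht).trans (le_of_eq ?_)
      rw [pow_succ]
      ring
  intro r t ht
  have hlim : Tendsto (fun k : ℕ => (∑ r, |B r|) * (1 / 2 : ℝ) ^ k) atTop (𝓝 0) := by
    simpa using (tendsto_pow_atTop_nhds_zero_of_lt_one (by norm_num)
      (by norm_num : (1 / 2 : ℝ) < 1)).const_mul (∑ r, |B r|)
  exact norm_le_zero_iff.1 (ge_of_tendsto' hlim fun k => hk k r t ht)

/-- In the difference of two solutions `g` and the inhomogeneous terms cancel, and `hδ` says that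
the remaining linear operator halves any uniform bound. -/
theorem eqOn_of_volterra {n : ℕ} {θ : Fin n → ℝ} (hθ : ∀ j, 0 < θ j) {δ P : ℝ} (hP : 0 ≤ P)
    {p : Fin n → Fin (n + 1) → ℝ → ℂ} (hp : ∀ j r, ContinuousOn (p j r) (Set.Icc 0 δ))
    (hpP : ∀ j r, ∀ t ∈ Set.Icc 0 δ, ‖p j r t‖ ≤ P)
    (hδ : ∀ j, n * P * (δ ^ θ j / Real.Gamma (θ j + 1)) ≤ 1 / 2)
    {g : Fin n → ℝ → ℂ} {v w : Fin n → ℝ → ℂ} (hv : ∀ r, ContinuousOn (v r) (Set.Icc 0 δ))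
    (hw : ∀ r, ContinuousOn (w r) (Set.Icc 0 δ))
    (hvg : ∀ j, ∀ t ∈ Set.Icc 0 δ, v j t = g j t + rlIntegral (θ j)
      (fun s => (∑ r : Fin n, p j r.castSucc s * v r s) + p j (Fin.last n) s) t)
    (hwg : ∀ j, ∀ t ∈ Set.Icc 0 δ, w j t = g j t + rlIntegral (θ j)
      (fun s => (∑ r : Fin n, p j r.castSucc s * w r s) + p j (Fin.last n) s) t)
    (j : Fin n) : Set.EqOn (v j) (w j) (Set.Icc 0 δ) := by
  suffices h : ∀ r, ∀ t ∈ Set.Icc 0 δ, v r t - w r t = 0 from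
    fun t ht => sub_eq_zero.1 (h j t ht)
  have hrhs : ∀ (j : Fin n) {u : Fin n → ℝ → ℂ}, (∀ r, ContinuousOn (u r) (Set.Icc 0 δ)) →
      ContinuousOn (fun s => (∑ r : Fin n, p j r.castSucc s * u r s) + p j (Fin.last n) s)
        (Set.Icc 0 δ) := fun j u hu =>
    (continuousOn_finsetSum _ fun r _ => (hp j _).mul (hu r)).add (hp j _)
  refine eq_zero_of_halving (fun r => (hv r).sub (hw r)) fun U hU hUb j t ht => ?_
  have hsub : Set.Icc 0 t ⊆ Set.Icc 0 δ := Set.Icc_subset_Icc_right ht.2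
  have hG : 0 < Real.Gamma (θ j + 1) := Real.Gamma_pos_of_pos (by linarith [hθ j])
  rw [hvg j t ht, hwg j t ht, add_sub_add_left_eq_sub,
    ← rlIntegral_sub (hθ j) ht.1 ((hrhs j hv).mono hsub) ((hrhs j hw).mono hsub)]
  have hbound : ∀ s ∈ Set.Icc 0 t,
      ‖((∑ r : Fin n, p j r.castSucc s * v r s) + p j (Fin.last n) s) -
        ((∑ r : Fin n, p j r.castSucc s * w r s) + p j (Fin.last n) s)‖ ≤ n * P * U := by
    intro s hs
    rw [add_sub_add_right_eq_sub, ← Finset.sum_sub_distrib]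
    refine (norm_sum_le_of_le _ fun r _ =>
      (?_ : _ ≤ P * U)).trans (le_of_eq ?_)
    · rw [← mul_sub, norm_mul]
      exact mul_le_mul (hpP j _ s (hsub hs)) (hUb r s (hsub hs)) (norm_nonneg _) hP
    · rw [Finset.sum_const, Finset.card_univ, Fintype.card_fin, nsmul_eq_mul, mul_assoc]
  calc _ ≤ n * P * U * (t ^ θ j / Real.Gamma (θ j + 1)) := norm_rlIntegral_le (hθ j) ht.1 hbound
    _ ≤ n * P * U * (δ ^ θ j / Real.Gamma (θ j + 1)) := by
        gcongr
        · exact ht.1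
        · exact (hθ j).le
        · exact ht.2
    _ = (n * P * (δ ^ θ j / Real.Gamma (θ j + 1))) * U := by ring
    _ ≤ 1 / 2 * U := mul_le_mul_of_nonneg_right (hδ j) hU
    _ = U / 2 := by ring

theorem exists_small {n : ℕ} {θ : Fin n → ℝ} (hθ : ∀ j, 0 < θ j) (P : ℝ) {δ₀ : ℝ}
    (hδ₀ : 0 < δ₀) :
    ∃ δ : ℝ, 0 < δ ∧ δ ≤ δ₀ ∧ ∀ j, n * P * (δ ^ θ j / Real.Gamma (θ j + 1)) ≤ 1 / 2 := by
  have h1 : ∀ j, ∀ᶠ δ in 𝓝[>] (0 : ℝ), n * P * (δ ^ θ j / Real.Gamma (θ j + 1)) ≤ 1 / 2 := by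
    intro j
    have h2 : Tendsto (fun δ : ℝ => n * P * (δ ^ θ j / Real.Gamma (θ j + 1))) (𝓝 0) (𝓝 0) := by
      have h3 := (((Real.continuous_rpow_const (hθ j).le).div_const
        (Real.Gamma (θ j + 1))).const_mul (n * P)).tendsto 0
      simpa [Real.zero_rpow (hθ j).ne'] using h3
    exact ((h2.mono_left nhdsWithin_le_nhds).eventually_lt_const
      (by norm_num : (0 : ℝ) < 1 / 2)).mono fun _ h => h.le
  have h4 : ∀ᶠ δ in 𝓝[>] (0 : ℝ), δ ∈ Set.Ioc 0 δ₀ := Ioc_mem_nhdsGT hδ₀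
  obtain ⟨δ, hδ, hδ'⟩ := ((eventually_all.2 h1).and h4).exists
  exact ⟨δ, hδ'.1, hδ'.2, hδ⟩

end FracSystem
end

theorem corollary2p2 {n : ℕ} (γ d : Fin n → ℕ)
    (hγ : ∀ j, 1 ≤ γ j) (hd : ∀ j, 2 ≤ d j) (hco : ∀ j, Nat.Coprime (γ j) (d j))
    (T : ℝ) (hT : 0 < T) (v0 : Fin n → ℕ → ℂ)
    (f : Fin n → Fin (n + 1) → ℝ → ℂ)
    (Ω : Set ℝ) (hΩ : Ω.Nonempty)
    (hcont : ∀ ω ∈ Ω, ∀ j r, ContinuousOn (FracSystem.oscCoeff f ω j r) (Set.Icc 0 T))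
    (hana : ∀ ω ∈ Ω, ∀ j r,
      FracSystem.IsAnalyticInRoot (FracSystem.lcmDen d) (FracSystem.oscCoeff f ω j r)) :
    ∃ (c : Fin n → Fin (n + 1) → ℕ → ℂ) (a : Fin n → ℕ → ℕ → ℂ),
      -- `c` are the coefficients of the expansions of `f` in powers of `t^(1/q)`
      (∃ δ : ℝ, 0 < δ ∧ ∀ j r, ∀ t ∈ Set.Icc 0 δ,
        HasSum (fun i : ℕ => c j r i * ((t ^ ((i : ℝ) / (FracSystem.lcmDen d : ℝ)) : ℝ) : ℂ))
          (f j r t)) ∧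
      -- dependence of the coefficients on the data and on the earlier coefficients only
      (∀ j m, ∀ z : ℂ, FracSystem.G a j m z =
        ∑ k ∈ Finset.range (m + 1),
          FracSystem.recCoeff γ d c (FracSystem.vbar γ d v0 a z) j m k
            * z ^ k / (k.factorial : ℂ)) ∧
      -- the series expansion of the solution
      (∀ ω ∈ Ω, ∃ δ : ℝ, 0 < δ ∧ δ ≤ T ∧ ∀ v : Fin n → ℝ → ℂ,
        FracSystem.IsSolution (FracSystem.order γ d) T v0 (FracSystem.oscCoeff f ω) v →
          ∀ j, ∀ t ∈ Set.Icc 0 δ,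
            HasSum (fun m : ℕ => FracSystem.G a j m (Complex.I * ω) *
                ((t ^ (((m + FracSystem.startIndex γ d j : ℕ) : ℝ) /
                  (FracSystem.lcmDen d : ℝ)) : ℝ) : ℂ))
              (v j t - FracSystem.psi (FracSystem.order γ d j) (v0 j) t)) := by
  -- A single frequency suffices to expand `f`; the resulting `c` serves all `ω`, since `f` does not
  -- depend on `ω`.
  obtain ⟨ω₀, hω₀⟩ := hΩ
  obtain ⟨c, δ₀, hδ₀, hf⟩ := FracSystem.exists_coeff_of_oscCoeff hd (hana ω₀ hω₀)
  refine ⟨c, FracSystem.solCoeff γ d c v0, ⟨δ₀, hδ₀, hf⟩,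
    FracSystem.G_solCoeff_eq_sum hγ hd c v0, fun ω hω => ?_⟩
  obtain ⟨δ₁, hδ₁, W, hWc, hW⟩ := FracSystem.exists_series_solution hγ hd v0 hδ₀ hf ω
  choose B hB using fun j r => isCompact_Icc.exists_bound_of_continuousOn (hcont ω hω j r)
  -- The sum of the `|B j r|` is a common bound for all `p_{j,r}` on `[0, T]`. It depends on `ω` but
  -- not on the solution, and so does `δ`.
  obtain ⟨δ, hδ, hδle, hsmall⟩ := FracSystem.exists_small (FracSystem.order_pos hγ hd)
    (∑ j, ∑ r, |B j r|) (lt_min hT hδ₁)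
  have hδT := hδle.trans (min_le_left _ _)
  have hδδ₁ := hδle.trans (min_le_right _ _)
  have hsubT : Set.Icc 0 δ ⊆ Set.Icc 0 T := Set.Icc_subset_Icc_right hδT
  have hsub₁ : Set.Icc 0 δ ⊆ Set.Icc 0 δ₁ := Set.Icc_subset_Icc_right hδδ₁
  refine ⟨δ, hδ, hδT, fun v hv j t ht => ?_⟩
  have heq := FracSystem.eqOn_of_volterra (FracSystem.order_pos hγ hd) (by positivity)
    (fun j r => (hcont ω hω j r).mono hsubT)
    (fun j r s hs => (hB j r s (hsubT hs)).trans ((le_abs_self _).trans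
      ((Finset.single_le_sum (f := fun r => |B j r|) (fun _ _ => abs_nonneg _)
        (Finset.mem_univ r)).trans
      (Finset.single_le_sum (f := fun j => ∑ r, |B j r|)
        (fun _ _ => Finset.sum_nonneg fun _ _ => abs_nonneg _) (Finset.mem_univ j)))))
    hsmall (g := fun j => FracSystem.psi (FracSystem.order γ d j) (v0 j))
    (fun r => (hv.contDiffOn r).continuousOn.mono hsubT) (fun r => (hWc r).mono hsub₁)
    (fun j t ht => hv.eq_psi_add_rlIntegral (FracSystem.order_pos hγ hd j)
      (FracSystem.order_lt_ceil hd hco j) (hsubT ht))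
    (fun j t ht => (hW j t (hsub₁ ht)).2) j ht
  rw [heq, (hW j t (hsub₁ ht)).2, add_sub_cancel_left]
  exact (hW j t (hsub₁ ht)).1
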